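/- Let $(S_j)_{j\ge 0}$ be simple random walk on $\mathbb{Z}^2$, with law $\mathbf{P}_z$ when $S_0=z$. For a finite nonempty set $A\subset\mathbb{Z}^2$ let $\tau_A=\inf\{j\ge 1: S_j\in A\}$, let $H_A(z,x)=\mathbf{P}_z(\tau_A<\infty,\ S_{\tau_A}=x)$ be the hitting distribution of $A$ from $z$, and let $H_A(x)=\lim_{|z|\to\infty}H_A(z,x)$ be the harmonic measure of $A$. There is a universal constant $c>0$ such that, for every $n\ge 1$, every $A\subset\mathbb{Z}^2$ with exactly $n$ elements and every $x\in\mathbb{Z}^2$, the limit defining $H_A(x)$ exists, and either $H_A(x)=0$ or \[ H_A(x)\ \ge\ e^{-c\,n\log n}. \] If moreover $A$ is connected (as a subset of the square lattice with nearest-neighbour edges), then either $H_A(x)=0$ or \[ H_A(x)\ \ge\ e^{-c\,n}. \] -/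

import Mathlib

open MeasureTheory Filter Topology

noncomputable section

namespace HarmonicMeasureZ2

/-- The four unit vectors of `ℤ²`. -/
def unitSteps : Finset (ℤ × ℤ) := {(1, 0), (-1, 0), (0, 1), (0, -1)}

theorem unitSteps_nonempty : unitSteps.Nonempty := ⟨(1, 0), by simp [unitSteps]⟩

/-- The law of one step of simple random walk: uniform on the four unit vectors. -/
def stepLaw : Measure (ℤ × ℤ) :=
  (PMF.uniformOfFinset unitSteps unitSteps_nonempty).toMeasure

instance : IsProbabilityMeasure stepLaw := by
  unfold stepLaw; infer_instance

/-- The law of an infinite sequence of independent steps. -/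
def stepsLaw : Measure (ℕ → ℤ × ℤ) := Measure.infinitePi (fun _ : ℕ => stepLaw)

/-- Simple random walk on `ℤ²` started from `x`: the position `S_t = x + ξ₀ + ⋯ + ξ_{t-1}`
as a function of the sequence `ξ` of steps. -/
def walk (x : ℤ × ℤ) (t : ℕ) (ξ : ℕ → ℤ × ℤ) : ℤ × ℤ := x + ∑ i ∈ Finset.range t, ξ i

/-- `τ_A = inf {t ≥ 1 : S_t ∈ A}` for simple random walk from `x` (with value `⊤` if the walk does
not visit `A` at any positive time). -/
def returnTime (A : Finset (ℤ × ℤ)) (x : ℤ × ℤ) : (ℕ → ℤ × ℤ) → WithTop ℕ :=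
  hittingAfter (walk x) (A : Set (ℤ × ℤ)) 1

/-- The hitting distribution of `A` from `x`: `H_A(x, y) = ℙ_x (τ_A < ∞, S_{τ_A} = y)`. -/
def hittingDist (A : Finset (ℤ × ℤ)) (x y : ℤ × ℤ) : ℝ :=
  stepsLaw.real {ξ | ∃ t : ℕ, returnTime A x ξ = (t : WithTop ℕ) ∧ walk x t ξ = y}

/-- The harmonic measure of `A`: `H_A(y) = lim_{|x| → ∞} H_A(x, y)`. -/
def harmonicMeasure (A : Finset (ℤ × ℤ)) (y : ℤ × ℤ) : ℝ :=
  limUnder (Bornology.cobounded (ℤ × ℤ)) (fun x => hittingDist A x y)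

/-- The square lattice as a graph: nearest neighbours are adjacent. -/
def squareLattice : SimpleGraph (ℤ × ℤ) where
  Adj p q := |p.1 - q.1| + |p.2 - q.2| = 1
  symm := ⟨fun p q h => by rw [abs_sub_comm q.1, abs_sub_comm q.2]; exact h⟩
  loopless := ⟨fun p h => by simp at h⟩

/-- `A` is connected in the square lattice. -/
def IsLatticeConnected (A : Finset (ℤ × ℤ)) : Prop :=
  (squareLattice.induce (A : Set (ℤ × ℤ))).Connected

end HarmonicMeasureZ2

end

namespace HarmonicMeasureZ2

/-! Translate so that x = 0, and let F(w) be the probability that the walk from w, observed from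
time 0, first meets A at the origin. Then 0 ≤ F ≤ 1, F is harmonic off A, F(0) = 1, F vanishes on
the rest of A, and H_A(x) is the limit of F at infinity. Every estimate compares F with explicit
functions that replace the potential kernel: `logUp` is subharmonic, `logDown` is superharmonic off
the origin, and both grow like log |w|². Since `logDown` tends to infinity, the maximum principle
holds on unbounded domains for functions bounded above (`max_principle`); this is recurrence.
Applied to F minus a number just below its liminf, `quarter_le_of_superharmonic` makes liminf and
limsup agree, so the limit exists.

Near the origin, `ring_lower_bound` gives a dichotomy at a free ring of radius O(n). Either the
origin cannot be joined to the ring off the other points of A, and F vanishes from the ring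
outwards; or it can be joined by a path of length O(n) hugging A (`connected_along_boundary`), each
step costing a factor 1/4. If A is connected, a free ring of radius at most n + 1 encloses it, and
`outside_step` carries the bound e^{-cn} to infinity.

For general A, `multiscale_lower_bound` moves outwards from one thick free ring to the next. If the
next obstacle is within a factor 64, `ring_step` finds a corridor through the m obstacles at that
scale, at a cost exponential in m and in the aspect ratio of the starting ring. Otherwise
`annulus_step` first crosses the empty annulus at cost O(n), however wide it is. Every round passes
an obstacle, so the total cost is e^{O(n)} n^{2n}. -/

instance : IsProbabilityMeasure stepsLaw := by
  unfold stepsLaw; infer_instance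

/-! ### Hitting probabilities and first-step analysis. -/

/-- Average of a function over the four neighbours of a lattice point. -/
noncomputable def nbrAvg (u : ℤ × ℤ → ℝ) (w : ℤ × ℤ) : ℝ :=
  (u (w + (1, 0)) + u (w + (-1, 0)) + u (w + (0, 1)) + u (w + (0, -1))) / 4

/-- The event that the walk from `z` first returns to `A` at the point `x`. -/
def firstHitEvent (A : Finset (ℤ × ℤ)) (x z : ℤ × ℤ) : Set (ℕ → ℤ × ℤ) :=
  {ξ | ∃ t : ℕ, walk z (t + 1) ξ ∈ A ∧ (∀ s < t, walk z (s + 1) ξ ∉ A) ∧ walk z (t + 1) ξ = x}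

theorem returnTime_eq_iff (A : Finset (ℤ × ℤ)) (z : ℤ × ℤ) (ξ : ℕ → ℤ × ℤ) (t : ℕ) :
    returnTime A z ξ = (t : WithTop ℕ) ↔
      1 ≤ t ∧ walk z t ξ ∈ A ∧ ∀ s, 1 ≤ s → s < t → walk z s ξ ∉ A := by
  unfold returnTime
  rw [hittingAfter_def]
  constructor
  · intro h
    dsimp only at h
    split_ifs at h with hex
    · have h' : sInf {i : ℕ | 1 ≤ i ∧ walk z i ξ ∈ (A : Set (ℤ × ℤ))} = t := by
        exact WithTop.coe_injective h
      have hmem := Nat.sInf_mem (s := {i : ℕ | 1 ≤ i ∧ walk z i ξ ∈ (A : Set (ℤ × ℤ))}) hex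
      rw [h'] at hmem
      refine ⟨hmem.1, by simpa using hmem.2, fun s hs hst hsA => ?_⟩
      have := Nat.notMem_of_lt_sInf (h'.symm ▸ hst :
        s < sInf {i : ℕ | 1 ≤ i ∧ walk z i ξ ∈ (A : Set (ℤ × ℤ))})
      exact this ⟨hs, by simpa using hsA⟩
    · exact absurd h (WithTop.top_ne_coe)
  · rintro ⟨h1, h2, h3⟩
    dsimp only
    rw [if_pos ⟨t, h1, by simpa using h2⟩]
    have : sInf {i : ℕ | 1 ≤ i ∧ walk z i ξ ∈ (A : Set (ℤ × ℤ))} = t := by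
      apply le_antisymm
      · exact Nat.sInf_le ⟨h1, by simpa using h2⟩
      · by_contra hlt
        push Not at hlt
        have hmem := Nat.sInf_mem (s := {i : ℕ | 1 ≤ i ∧ walk z i ξ ∈ (A : Set (ℤ × ℤ))})
          ⟨t, h1, by simpa using h2⟩
        exact h3 _ hmem.1 hlt (by simpa using hmem.2)
    exact congrArg WithTop.some this

theorem hittingDist_eq (A : Finset (ℤ × ℤ)) (z x : ℤ × ℤ) :
    hittingDist A z x = stepsLaw.real (firstHitEvent A x z) := by
  unfold hittingDist
  congr 1
  ext ξ
  simp only [returnTime_eq_iff, firstHitEvent, Set.mem_ofPred_eq]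
  constructor
  · rintro ⟨t, ⟨h1, h2, h3⟩, h4⟩
    obtain ⟨t, rfl⟩ : ∃ k, t = k + 1 := ⟨t - 1, by omega⟩
    exact ⟨t, h2, fun s hs => h3 _ (by omega) (by omega), h4⟩
  · rintro ⟨t, h2, h3, h4⟩
    refine ⟨t + 1, ⟨by omega, h2, fun s hs hst => ?_⟩, h4⟩
    obtain ⟨s, rfl⟩ : ∃ k, s = k + 1 := ⟨s - 1, by omega⟩
    exact h3 s (by omega)

theorem measurable_walk (z : ℤ × ℤ) (t : ℕ) : Measurable (walk z t) := by
  unfold walk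
  fun_prop

theorem measurableSet_firstHitEvent (A : Finset (ℤ × ℤ)) (x z : ℤ × ℤ) :
    MeasurableSet (firstHitEvent A x z) := by
  have hA : ∀ t, MeasurableSet {ξ | walk z t ξ ∈ A} := fun t =>
    measurable_walk z t (A.finite_toSet.measurableSet)
  have hx : ∀ t, MeasurableSet {ξ | walk z t ξ = x} := fun t =>
    measurable_walk z t (measurableSet_singleton x)
  have : firstHitEvent A x z = ⋃ t : ℕ, ({ξ | walk z (t + 1) ξ ∈ A} ∩
      ((⋂ s : ℕ, ⋂ _ : s < t, {ξ | walk z (s + 1) ξ ∈ A}ᶜ) ∩ {ξ | walk z (t + 1) ξ = x})) := by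
    ext ξ; simp [firstHitEvent]
  rw [this]
  refine MeasurableSet.iUnion fun t => (hA _).inter (MeasurableSet.inter ?_ (hx _))
  exact MeasurableSet.iInter fun s => MeasurableSet.iInter fun _ => (hA _).compl

/-- Prepend a step to a sequence of steps. -/
def consStep (p : (ℤ × ℤ) × (ℕ → ℤ × ℤ)) : ℕ → ℤ × ℤ := fun n => Nat.casesOn n p.1 p.2

theorem measurable_consStep : Measurable consStep := by
  refine measurable_pi_lambda _ fun n => ?_
  cases n with
  | zero => exact measurable_fst
  | succ n => exact (measurable_pi_apply n).comp measurable_snd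

/-- This is the Markov property at time one. It suffices to compare masses of finite-dimensional
boxes, and the preimage of a box is a product of a condition on the first step and a box with
shifted indices. -/
theorem map_consStep : (stepLaw.prod stepsLaw).map consStep = stepsLaw := by
  unfold stepsLaw
  apply Measure.eq_infinitePi
  intro s t ht
  rw [Measure.map_apply measurable_consStep (MeasurableSet.pi s.countable_toSet fun i _ => ht i)]
  have hpre : consStep ⁻¹' (Set.pi s t) =
      (if 0 ∈ s then t 0 else Set.univ) ×ˢ
        Set.pi ((s.erase 0).image Nat.pred) (fun i => t (i + 1)) := by
    ext ⟨a, b⟩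
    simp only [Set.mem_preimage, Set.mem_pi, Finset.mem_coe, Set.mem_prod, Finset.mem_image,
      Finset.mem_erase]
    constructor
    · intro h
      refine ⟨?_, ?_⟩
      · split_ifs with h0
        · exact h 0 h0
        · trivial
      · rintro i ⟨j, ⟨hj0, hj⟩, rfl⟩
        obtain ⟨j, rfl⟩ := Nat.exists_eq_succ_of_ne_zero hj0
        exact h _ hj
    · rintro ⟨h0, h1⟩ i hi
      cases i with
      | zero => rw [if_pos hi] at h0; exact h0
      | succ i => exact h1 i ⟨i + 1, ⟨by omega, hi⟩, rfl⟩
  rw [hpre, Measure.prod_prod, Measure.infinitePi_pi _ (fun i _ => ht _)]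
  rw [Finset.prod_image]
  · have : ∏ i ∈ s.erase 0, stepLaw (t (i.pred + 1)) = ∏ i ∈ s.erase 0, stepLaw (t i) := by
      refine Finset.prod_congr rfl fun i hi => ?_
      have : i.pred + 1 = i := Nat.succ_pred_eq_of_ne_zero (Finset.ne_of_mem_erase hi)
      rw [this]
    rw [this]
    split_ifs with h0
    · rw [Finset.mul_prod_erase s (fun i => stepLaw (t i)) h0]
    · rw [measure_univ, one_mul, Finset.erase_eq_of_notMem h0]
  · intro i hi j hj hij
    simp only [Finset.coe_erase, Set.mem_sdiff, Set.mem_singleton_iff] at hi hj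
    have := Nat.succ_pred_eq_of_ne_zero hi.2
    have := Nat.succ_pred_eq_of_ne_zero hj.2
    simp only [Nat.succ_eq_add_one] at *
    omega

theorem walk_consStep (z e : ℤ × ℤ) (ξ : ℕ → ℤ × ℤ) (t : ℕ) :
    walk z (t + 1) (consStep (e, ξ)) = walk (z + e) t ξ := by
  unfold walk
  rw [Finset.sum_range_succ']
  simp only [consStep]
  abel

theorem consStep_mem_firstHitEvent (A : Finset (ℤ × ℤ)) (x z e : ℤ × ℤ) (ξ : ℕ → ℤ × ℤ) :
    consStep (e, ξ) ∈ firstHitEvent A x z ↔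
      (z + e ∈ A ∧ z + e = x) ∨ (z + e ∉ A ∧ ξ ∈ firstHitEvent A x (z + e)) := by
  have h0 : walk (z + e) 0 ξ = z + e := by simp [walk]
  simp only [firstHitEvent, Set.mem_ofPred_eq, walk_consStep]
  constructor
  · rintro ⟨t, h1, h2, h3⟩
    cases t with
    | zero => left; rw [h0] at h1 h3; exact ⟨h1, h3⟩
    | succ t =>
      right
      refine ⟨?_, t, h1, fun s hs => h2 (s + 1) (by omega), h3⟩
      have := h2 0 (by omega)
      rwa [h0] at this
  · rintro (⟨h1, h2⟩ | ⟨h1, t, h2, h3, h4⟩)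
    · exact ⟨0, by rwa [h0], fun s hs => by omega, by rwa [h0]⟩
    · refine ⟨t + 1, h2, fun s hs => ?_, h4⟩
      cases s with
      | zero => rwa [h0]
      | succ s => exact h3 s (by omega)

/-- The probability that the walk from `z`, observed from time `0` on, first meets `A` at `x`. -/
noncomputable def hitProb (A : Finset (ℤ × ℤ)) (x z : ℤ × ℤ) : ℝ :=
  open Classical in
  if z ∈ A then (if z = x then 1 else 0) else hittingDist A z x

theorem stepLaw_singleton (e : ℤ × ℤ) :
    stepLaw {e} = if e ∈ unitSteps then (4 : ENNReal)⁻¹ else 0 := by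
  unfold stepLaw
  rw [PMF.toMeasure_apply_singleton _ _ (measurableSet_singleton e), PMF.uniformOfFinset_apply]
  have : unitSteps.card = 4 := by decide
  rw [this]; norm_num

/-- First-step decomposition. It holds for z in A too, because `returnTime` ignores time 0, whereas
`hitProb` carries the boundary values. Off A the two functions agree, which makes `hitProb` harmonic
there. -/
theorem hittingDist_eq_nbrAvg (A : Finset (ℤ × ℤ)) (x z : ℤ × ℤ) :
    hittingDist A z x = nbrAvg (hitProb A x) z := by
  classical
  rw [hittingDist_eq, measureReal_def]
  have hm := measurableSet_firstHitEvent A x z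
  conv_lhs => rw [← map_consStep]
  rw [Measure.map_apply measurable_consStep hm,
    Measure.prod_apply (measurable_consStep hm)]
  have hfib : ∀ e, stepsLaw (Prod.mk e ⁻¹' (consStep ⁻¹' firstHitEvent A x z)) =
      ENNReal.ofReal (hitProb A x (z + e)) := by
    intro e
    have : Prod.mk e ⁻¹' (consStep ⁻¹' firstHitEvent A x z) =
        {ξ | (z + e ∈ A ∧ z + e = x) ∨ (z + e ∉ A ∧ ξ ∈ firstHitEvent A x (z + e))} := by
      ext ξ
      simp only [Set.mem_preimage, consStep_mem_firstHitEvent, Set.mem_ofPred_eq]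
    rw [this]
    unfold hitProb
    by_cases h1 : z + e ∈ A
    · by_cases h2 : z + e = x
      · have hxA : x ∈ A := h2 ▸ h1
        simp [h2, hxA]
      · simp [h1, h2]
    · simp only [h1, false_and, not_false_eq_true, true_and, false_or, Set.ofPred_mem_eq, if_false]
      rw [hittingDist_eq, measureReal_def, ENNReal.ofReal_toReal (measure_ne_top _ _)]
  simp_rw [hfib]
  have hnn : ∀ w, 0 ≤ hitProb A x w := by
    intro w; unfold hitProb
    split_ifs
    · exact zero_le_one
    · exact le_rfl
    · rw [hittingDist_eq]; exact measureReal_nonneg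
  rw [lintegral_countable']
  rw [tsum_eq_sum (s := unitSteps)]
  · have hs : ∀ e ∈ unitSteps, ENNReal.ofReal (hitProb A x (z + e)) * stepLaw {e} =
        ENNReal.ofReal (hitProb A x (z + e) / 4) := by
      intro e he
      rw [stepLaw_singleton, if_pos he, ENNReal.ofReal_div_of_pos (by norm_num), div_eq_mul_inv]
      norm_num
    rw [Finset.sum_congr rfl hs, ← ENNReal.ofReal_sum_of_nonneg, ENNReal.toReal_ofReal]
    · unfold nbrAvg unitSteps
      rw [Finset.sum_insert (by decide), Finset.sum_insert (by decide),
        Finset.sum_insert (by decide), Finset.sum_singleton]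
      ring
    · exact Finset.sum_nonneg fun e _ => div_nonneg (hnn _) (by norm_num)
    · exact fun e _ => div_nonneg (hnn _) (by norm_num)
  · intro e he
    rw [stepLaw_singleton, if_neg he, mul_zero]

theorem hitProb_nonneg (A : Finset (ℤ × ℤ)) (x z : ℤ × ℤ) : 0 ≤ hitProb A x z := by
  unfold hitProb
  split_ifs
  · exact zero_le_one
  · exact le_rfl
  · rw [hittingDist_eq]; exact measureReal_nonneg

theorem hitProb_le_one (A : Finset (ℤ × ℤ)) (x z : ℤ × ℤ) : hitProb A x z ≤ 1 := by
  unfold hitProb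
  split_ifs
  · exact le_rfl
  · exact zero_le_one
  · rw [hittingDist_eq]; exact measureReal_le_one

/-! ### Norms and explicit logarithmic barriers. -/

/-- The sup norm on the lattice. -/
def supN (w : ℤ × ℤ) : ℤ := max |w.1| |w.2|

/-- The square of the Euclidean norm on the lattice. -/
def sqN (w : ℤ × ℤ) : ℤ := w.1 ^ 2 + w.2 ^ 2

theorem supN_nonneg (w : ℤ × ℤ) : 0 ≤ supN w := le_max_of_le_left (abs_nonneg _)

theorem supN_le_iff {w : ℤ × ℤ} {k : ℤ} : supN w ≤ k ↔ |w.1| ≤ k ∧ |w.2| ≤ k := max_le_iff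

theorem supN_add_le (v w : ℤ × ℤ) : supN (v + w) ≤ supN v + supN w := by
  rw [supN_le_iff]
  exact ⟨(abs_add_le _ _).trans (add_le_add (le_max_left _ _) (le_max_left _ _)),
    (abs_add_le _ _).trans (add_le_add (le_max_right _ _) (le_max_right _ _))⟩

theorem supN_neg (w : ℤ × ℤ) : supN (-w) = supN w := by simp [supN]

theorem supN_sub_comm (v w : ℤ × ℤ) : supN (v - w) = supN (w - v) := by
  rw [← supN_neg, neg_sub]

theorem supN_sub_le (u v w : ℤ × ℤ) : supN (u - w) ≤ supN (u - v) + supN (v - w) := by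
  have := supN_add_le (u - v) (v - w)
  rwa [sub_add_sub_cancel] at this

theorem le_supN_sub (v w : ℤ × ℤ) : supN v - supN w ≤ supN (v - w) := by
  have := supN_add_le (v - w) w
  rw [sub_add_cancel] at this
  linarith

theorem sqN_nonneg (w : ℤ × ℤ) : 0 ≤ sqN w := by unfold sqN; positivity

theorem supN_sq_le_sqN (w : ℤ × ℤ) : supN w ^ 2 ≤ sqN w := by
  unfold supN sqN
  rcases max_choice |w.1| |w.2| with h | h <;> rw [h, sq_abs] <;> nlinarith [sq_nonneg w.1, sq_nonneg w.2]

theorem sqN_le_two_mul_supN_sq (w : ℤ × ℤ) : sqN w ≤ 2 * supN w ^ 2 := by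
  have h1 : w.1 ^ 2 ≤ supN w ^ 2 := by
    rw [← sq_abs w.1]; exact pow_le_pow_left₀ (abs_nonneg _) (le_max_left _ _) 2
  have h2 : w.2 ^ 2 ≤ supN w ^ 2 := by
    rw [← sq_abs w.2]; exact pow_le_pow_left₀ (abs_nonneg _) (le_max_right _ _) 2
  unfold sqN; linarith

theorem sqN_eq_zero {w : ℤ × ℤ} (h : sqN w = 0) : w = 0 := by
  unfold sqN at h
  have h1 : w.1 = 0 := by nlinarith [sq_nonneg w.1, sq_nonneg w.2]
  have h2 : w.2 = 0 := by nlinarith [sq_nonneg w.1, sq_nonneg w.2]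
  exact Prod.ext h1 h2

theorem eq_zero_of_supN {w : ℤ × ℤ} (h : supN w = 0) : w = 0 := by
  have := sqN_le_two_mul_supN_sq w
  rw [h] at this
  exact sqN_eq_zero (le_antisymm (by simpa using this) (sqN_nonneg w))

theorem finite_supN_le (k : ℤ) : {w : ℤ × ℤ | supN w ≤ k}.Finite := by
  refine ((Set.finite_Icc (-k) k).prod (Set.finite_Icc (-k) k)).subset fun w hw => ?_
  have := supN_le_iff.mp hw
  exact ⟨abs_le.mp this.1, abs_le.mp this.2⟩

theorem nbrAvg_comp_sub (u : ℤ × ℤ → ℝ) (p w : ℤ × ℤ) :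
    nbrAvg (fun v => u (v - p)) w = nbrAvg u (w - p) := by
  unfold nbrAvg
  simp only [add_sub_right_comm]

theorem nbrAvg_le_nbrAvg {u v : ℤ × ℤ → ℝ} {w : ℤ × ℤ}
    (h : ∀ e ∈ unitSteps, u (w + e) ≤ v (w + e)) : nbrAvg u w ≤ nbrAvg v w := by
  simp only [unitSteps, Finset.mem_insert, Finset.mem_singleton, forall_eq_or_imp, forall_eq] at h
  unfold nbrAvg
  linarith [h.1, h.2.1, h.2.2.1, h.2.2.2]

theorem supN_unitSteps {e : ℤ × ℤ} (he : e ∈ unitSteps) : supN e = 1 := by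
  simp only [unitSteps, Finset.mem_insert, Finset.mem_singleton] at he
  rcases he with rfl | rfl | rfl | rfl <;> rfl

/-- An explicit subharmonic function of logarithmic growth. -/
noncomputable def logUp (w : ℤ × ℤ) : ℝ := Real.log (sqN w + 1 / 2)

/-- After exponentiation this is a polynomial inequality. With s = a² + b² + 1/2 the product over
the neighbours is s⁴ + 4s + 3 + 16a²b²: the shift 1/2 cancels the cubic and quadratic terms. -/
theorem logUp_subharmonic (w : ℤ × ℤ) : logUp w ≤ nbrAvg logUp w := by
  have hpos : ∀ v : ℤ × ℤ, (0 : ℝ) < sqN v + 1 / 2 := fun v => by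
    have : (0 : ℝ) ≤ sqN v := by exact_mod_cast sqN_nonneg v
    linarith
  unfold nbrAvg logUp
  rw [le_div_iff₀ (by norm_num), ← Real.log_mul (hpos _).ne' (hpos _).ne',
    ← Real.log_mul (mul_pos (hpos _) (hpos _)).ne' (hpos _).ne',
    ← Real.log_mul (mul_pos (mul_pos (hpos _) (hpos _)) (hpos _)).ne' (hpos _).ne', mul_comm,
    ← Nat.cast_ofNat (R := ℝ) (n := 4), ← Real.log_pow]
  apply Real.log_le_log (pow_pos (hpos _) _)
  obtain ⟨x, y⟩ := w
  simp only [sqN, Prod.mk_add_mk]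
  push_cast
  generalize (x : ℝ) = a at *
  generalize (y : ℝ) = b at *
  have : (0:ℝ) ≤ a^2+b^2 := by positivity
  nlinarith [mul_nonneg (sq_nonneg a) (sq_nonneg b)]

/-- The argument of the logarithm in `logDown`, as a function of the squared norm. -/
noncomputable def logDownArg (k : ℤ) : ℝ := if k = 0 then 1 / 768 else if k = 1 then 1 / 4 else k - 1

/-- An explicit function of logarithmic growth that is superharmonic away from the origin. -/
noncomputable def logDown (w : ℤ × ℤ) : ℝ := Real.log (logDownArg (sqN w))

theorem logDownArg_pos {k : ℤ} (hk : 0 ≤ k) : 0 < logDownArg k := by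
  unfold logDownArg
  split_ifs
  · norm_num
  · norm_num
  · have : (2 : ℝ) ≤ k := by exact_mod_cast (by omega : 2 ≤ k)
    linarith

theorem logDownArg_of_two_le {k : ℤ} (hk : 2 ≤ k) : logDownArg k = k - 1 := by
  unfold logDownArg
  rw [if_neg (by omega), if_neg (by omega)]

theorem logDownArg_mono {k l : ℤ} (hk : 0 ≤ k) (h : k ≤ l) : logDownArg k ≤ logDownArg l := by
  have hl : 2 ≤ l → (1 : ℝ) ≤ l - 1 := fun h => by
    have : (2 : ℝ) ≤ l := by exact_mod_cast h
    linarith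
  have hkl : (k : ℝ) ≤ l := by exact_mod_cast h
  unfold logDownArg
  split_ifs with h1 h2 h3 h4 h5 h6 h7
  any_goals omega
  any_goals norm_num
  · have := hl (by omega); linarith
  · have := hl (by omega); linarith
  · linarith

theorem logDownArg_le {k : ℤ} (hk : 1 ≤ k) : logDownArg k ≤ k := by
  have : (1 : ℝ) ≤ k := by exact_mod_cast hk
  unfold logDownArg
  split_ifs with h1 h2
  · linarith
  · linarith
  · linarith

/-- With m = a² + b² ≥ 5 the product over the neighbours is m⁴ - 4m³ + 16a²b² ≤ m⁴ - 4m³ + 4m²,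
which is below (m - 1)⁴. Small m is checked point by point. -/
theorem logDown_superharmonic {w : ℤ × ℤ} (hw : w ≠ 0) : nbrAvg logDown w ≤ logDown w := by
  have hpos : ∀ v : ℤ × ℤ, (0 : ℝ) < logDownArg (sqN v) := fun v => logDownArg_pos (sqN_nonneg v)
  unfold nbrAvg logDown
  rw [div_le_iff₀ (by norm_num), ← Real.log_mul (hpos _).ne' (hpos _).ne',
    ← Real.log_mul (mul_pos (hpos _) (hpos _)).ne' (hpos _).ne',
    ← Real.log_mul (mul_pos (mul_pos (hpos _) (hpos _)) (hpos _)).ne' (hpos _).ne', mul_comm _ (4:ℝ),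
    ← Nat.cast_ofNat (R := ℝ) (n := 4), ← Real.log_pow]
  apply Real.log_le_log (mul_pos (mul_pos (mul_pos (hpos _) (hpos _)) (hpos _)) (hpos _))
  obtain ⟨x, y⟩ := w
  by_cases hs : sqN (x, y) ≤ 4
  · have hx : |x| ≤ 2 := by
      simp only [sqN] at hs
      exact abs_le.mpr ⟨by nlinarith [sq_nonneg y], by nlinarith [sq_nonneg y]⟩
    have hy : |y| ≤ 2 := by
      simp only [sqN] at hs
      exact abs_le.mpr ⟨by nlinarith [sq_nonneg x], by nlinarith [sq_nonneg x]⟩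
    obtain ⟨hx1, hx2⟩ := abs_le.mp hx
    obtain ⟨hy1, hy2⟩ := abs_le.mp hy
    -- The special values of `logDownArg` are sharp here: 1/4 gives equality at squared norm 2,
    -- where (1/4)² · 4² = 1, and 1/768 gives equality at squared norm 1, where 3/768 = (1/4)⁴.
    interval_cases x <;> interval_cases y <;> first
      | exact absurd rfl hw
      | (exfalso; revert hs; decide)
      | (norm_num [sqN, logDownArg])
  · have hn : 5 ≤ sqN (x, y) := by omega
    have h5 : ∀ e ∈ unitSteps, 2 ≤ sqN ((x, y) + e) := by
      intro e he
      simp only [unitSteps, Finset.mem_insert, Finset.mem_singleton] at he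
      simp only [sqN] at hn
      rcases he with rfl | rfl | rfl | rfl <;> simp only [sqN, Prod.mk_add_mk] <;>
        nlinarith [sq_nonneg (x + 2), sq_nonneg (x - 2), sq_nonneg (y + 2), sq_nonneg (y - 2)]
    simp only [unitSteps, Finset.mem_insert, Finset.mem_singleton, forall_eq_or_imp,
      forall_eq] at h5
    obtain ⟨h1, h2, h3, h4⟩ := h5
    rw [logDownArg_of_two_le h1, logDownArg_of_two_le h2, logDownArg_of_two_le h3,
      logDownArg_of_two_le h4, logDownArg_of_two_le (by omega)]
    have hn' : (5 : ℝ) ≤ (x : ℝ) ^ 2 + (y : ℝ) ^ 2 := by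
      simp only [sqN] at hn; exact_mod_cast hn
    simp only [sqN, Prod.mk_add_mk]
    push_cast
    generalize (x : ℝ) = a at *
    generalize (y : ℝ) = b at *
    have key : 16 * (a ^ 2 * b ^ 2) ≤ 4 * (a ^ 2 + b ^ 2) ^ 2 := by
      nlinarith [sq_nonneg (a ^ 2 - b ^ 2)]
    nlinarith [mul_nonneg (sq_nonneg a) (sq_nonneg b)]

theorem logDown_mono {v w : ℤ × ℤ} (h : sqN v ≤ sqN w) : logDown v ≤ logDown w :=
  Real.log_le_log (logDownArg_pos (sqN_nonneg v)) (logDownArg_mono (sqN_nonneg v) h)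

theorem neg_log_le_logDown (w : ℤ × ℤ) : -Real.log 768 ≤ logDown w := by
  have : logDown 0 = -Real.log 768 := by
    simp [logDown, sqN, logDownArg]
  rw [← this]
  exact logDown_mono (by simpa [sqN] using sqN_nonneg w)

theorem logDown_le {w : ℤ × ℤ} (hw : 1 ≤ sqN w) : logDown w ≤ Real.log (sqN w) :=
  Real.log_le_log (logDownArg_pos (sqN_nonneg w)) (logDownArg_le hw)

theorem log_le_logDown {w : ℤ × ℤ} {s : ℤ} (hs : 2 ≤ s) (hw : s ≤ supN w) :
    Real.log ((s : ℝ) ^ 2 - 1) ≤ logDown w := by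
  have h1 : s ^ 2 ≤ sqN w := (pow_le_pow_left₀ (by omega) hw 2).trans (supN_sq_le_sqN w)
  have h2 : logDownArg (s ^ 2) = (s : ℝ) ^ 2 - 1 := by
    rw [logDownArg_of_two_le (by nlinarith)]; push_cast; ring
  rw [← h2]
  exact Real.log_le_log (logDownArg_pos (by positivity)) (logDownArg_mono (by positivity) h1)

theorem logDown_le_of_supN_le {w : ℤ × ℤ} {s : ℤ} (hs : 1 ≤ supN w) (hw : supN w ≤ s) :
    logDown w ≤ Real.log (2 * (s : ℝ) ^ 2) := by
  have h1 : sqN w ≤ 2 * s ^ 2 := (sqN_le_two_mul_supN_sq w).trans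
    (by have := pow_le_pow_left₀ (supN_nonneg w) hw 2; omega)
  have h2 : 1 ≤ sqN w := le_trans (by nlinarith) (supN_sq_le_sqN w)
  refine (logDown_le h2).trans (Real.log_le_log (by exact_mod_cast (by omega)) ?_)
  exact_mod_cast h1

theorem logDown_bound_finite (M : ℝ) : {w : ℤ × ℤ | logDown w ≤ M}.Finite := by
  refine (finite_supN_le (⌈Real.exp M⌉ + 2)).subset fun w hw => ?_
  by_contra hlt
  simp only [Set.mem_ofPred_eq, not_le] at hw hlt
  have h0 : (0 : ℤ) < ⌈Real.exp M⌉ := Int.ceil_pos.mpr (Real.exp_pos M)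
  have h1 := log_le_logDown (w := w) (s := ⌈Real.exp M⌉ + 2) (by omega) hlt.le
  have h2 : M < Real.log (((⌈Real.exp M⌉ + 2 : ℤ) : ℝ) ^ 2 - 1) := by
    rw [Real.lt_log_iff_exp_lt]
    · have := Int.le_ceil (Real.exp M)
      push_cast
      nlinarith [Real.exp_pos M]
    · have := Int.le_ceil (Real.exp M)
      push_cast
      nlinarith [Real.exp_pos M]
  linarith

/-! ### The maximum principle. -/

/-- Maximum principle for functions bounded above on a proper subset of the lattice: recurrence of
the walk makes infinity negligible. -/
theorem max_principle {Ω : Set (ℤ × ℤ)} (hΩ : Ωᶜ.Nonempty) {u : ℤ × ℤ → ℝ} {C : ℝ}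
    (hC : ∀ w ∈ Ω, u w ≤ C) (hsub : ∀ w ∈ Ω, u w ≤ nbrAvg u w)
    (hbd : ∀ w ∈ Ω, ∀ e ∈ unitSteps, w + e ∉ Ω → u (w + e) ≤ 0) : ∀ w ∈ Ω, u w ≤ 0 := by
  classical
  obtain ⟨x₀, hx₀⟩ := hΩ
  intro w₀ hw₀
  by_contra hpos
  push Not at hpos
  -- A nonnegative penalty tending to infinity and superharmonic on Ω, as its pole x₀ lies outside.
  -- Subtracting a small multiple forces the maximum to be attained.
  set g : ℤ × ℤ → ℝ := fun w => logDown (w - x₀) + Real.log 768 with hg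
  have hg0 : ∀ w, 0 ≤ g w := fun w => by
    have := neg_log_le_logDown (w - x₀); simp only [hg]; linarith
  obtain ⟨ε, hε, hεw⟩ : ∃ ε > 0, 0 < u w₀ - ε * g w₀ := by
    refine ⟨u w₀ / (2 * (g w₀ + 1)), by have := hg0 w₀; positivity, ?_⟩
    have := hg0 w₀
    have h1 : u w₀ / (2 * (g w₀ + 1)) * g w₀ = u w₀ / 2 * (g w₀ / (g w₀ + 1)) := by
      field_simp
    have h2 : g w₀ / (g w₀ + 1) ≤ 1 := by rw [div_le_one (by linarith)]; linarith
    rw [h1]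
    nlinarith
  -- Off Ω the sign of u is known only next to Ω; truncation makes v nonpositive on the whole
  -- complement without changing it at neighbours of Ω.
  set v : ℤ × ℤ → ℝ := fun w => if w ∈ Ω then u w - ε * g w else min (u w) 0 - ε * g w with hv
  have hvΩ : ∀ w, 0 < v w → w ∈ Ω := by
    intro w hw
    by_contra hn
    simp only [hv, if_neg hn] at hw
    have := min_le_right (u w) 0
    have := mul_nonneg hε.le (hg0 w)
    linarith
  have hfin : {w | 0 < v w}.Finite := by
    refine (((logDown_bound_finite (C / ε)).image (fun w => w + x₀))).subset fun w hw => ?_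
    have hwΩ := hvΩ w hw
    refine ⟨w - x₀, ?_, by simp⟩
    simp only [Set.mem_ofPred_eq, hv, if_pos hwΩ] at hw
    have := hC w hwΩ
    have h768 : 0 < Real.log 768 := Real.log_pos (by norm_num)
    simp only [Set.mem_ofPred_eq, le_div_iff₀ hε]
    simp only [hg] at hw
    nlinarith
  have hw₀v : 0 < v w₀ := by simp only [hv, if_pos hw₀]; exact hεw
  obtain ⟨w₁, hw₁, hmax⟩ := hfin.exists_maximalFor v _ ⟨w₀, hw₀v⟩
  have hmax' : ∀ w, v w ≤ v w₁ := by
    intro w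
    by_cases h : 0 < v w
    · by_contra hlt
      push Not at hlt
      exact absurd (hmax h hlt.le) (not_le.mpr hlt)
    · exact (not_lt.mp h).trans (le_of_lt hw₁)
  have hfin2 : {w | v w = v w₁}.Finite := hfin.subset fun w hw => by
    simp only [Set.mem_ofPred_eq] at hw ⊢; rw [hw]; exact hw₁
  -- At a rightmost maximiser the right neighbour has a strictly smaller value, which contradicts
  -- the mean value inequality.
  obtain ⟨w₂, hw₂, hmax2⟩ := hfin2.exists_maximalFor Prod.fst _ ⟨w₁, rfl⟩
  have hw₂Ω : w₂ ∈ Ω := hvΩ _ (by simp only [Set.mem_ofPred_eq] at hw₂; rw [hw₂]; exact hw₁)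
  have hsubv : v w₂ ≤ nbrAvg v w₂ := by
    have h1 : v w₂ = u w₂ - ε * g w₂ := by simp only [hv, if_pos hw₂Ω]
    have h2 : nbrAvg u w₂ - ε * nbrAvg g w₂ = nbrAvg (fun w => u w - ε * g w) w₂ := by
      unfold nbrAvg; ring
    have h3 : nbrAvg g w₂ ≤ g w₂ := by
      have h4 : nbrAvg g w₂ = nbrAvg logDown (w₂ - x₀) + Real.log 768 := by
        rw [← nbrAvg_comp_sub]; unfold nbrAvg; simp only [hg]; ring
      rw [h4]
      have := logDown_superharmonic (w := w₂ - x₀)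
        (sub_ne_zero.mpr fun h => hx₀ (h ▸ hw₂Ω))
      simp only [hg]; linarith
    have h5 : nbrAvg (fun w => u w - ε * g w) w₂ ≤ nbrAvg v w₂ := by
      apply nbrAvg_le_nbrAvg
      intro e he
      simp only [hv]
      split_ifs with h
      · exact le_rfl
      · rw [min_eq_left (hbd w₂ hw₂Ω e he h)]
    have := hsub w₂ hw₂Ω
    have := mul_le_mul_of_nonneg_left h3 hε.le
    linarith
  have hlt : v (w₂ + (1, 0)) < v w₁ := by
    refine lt_of_le_of_ne (hmax' _) fun heq => ?_
    have := hmax2 (j := w₂ + (1, 0)) heq (by simp)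
    simp at this
  simp only [Set.mem_ofPred_eq] at hw₂
  have h1 := hmax' (w₂ + (-1, 0))
  have h2 := hmax' (w₂ + (0, 1))
  have h3 := hmax' (w₂ + (0, -1))
  unfold nbrAvg at hsubv
  linarith

/-- Comparison of a subharmonic function with a superharmonic one. -/
theorem comparison {Ω : Set (ℤ × ℤ)} (hΩ : Ωᶜ.Nonempty) {φ F : ℤ × ℤ → ℝ} {C : ℝ}
    (hC : ∀ w ∈ Ω, φ w ≤ C) (hF : ∀ w ∈ Ω, 0 ≤ F w)
    (hφ : ∀ w ∈ Ω, φ w ≤ nbrAvg φ w) (hFs : ∀ w ∈ Ω, nbrAvg F w ≤ F w)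
    (hbd : ∀ w ∈ Ω, ∀ e ∈ unitSteps, w + e ∉ Ω → φ (w + e) ≤ F (w + e)) :
    ∀ w ∈ Ω, φ w ≤ F w := by
  intro w hw
  have := max_principle hΩ (u := fun w => φ w - F w) (C := C)
    (fun w hw => by linarith [hC w hw, hF w hw])
    (fun w hw => by
      have h : nbrAvg (fun w => φ w - F w) w = nbrAvg φ w - nbrAvg F w := by unfold nbrAvg; ring
      rw [h]; linarith [hφ w hw, hFs w hw])
    (fun w hw e he h => by linarith [hbd w hw e he h]) w hw
  linarith

/-! ### Behaviour at infinity and existence of the limit. -/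

theorem cobounded_eq_cofinite : Bornology.cobounded (ℤ × ℤ) = Filter.cofinite := by
  rw [Metric.cobounded_eq_cocompact, Filter.cocompact_eq_cofinite]

theorem eventually_cobounded_iff {P : ℤ × ℤ → Prop} :
    (∀ᶠ w in Bornology.cobounded (ℤ × ℤ), P w) ↔ ∃ r : ℤ, ∀ w, r ≤ supN w → P w := by
  rw [cobounded_eq_cofinite, Filter.eventually_cofinite]
  constructor
  · intro h
    obtain ⟨r, hr⟩ := (h.image supN).bddAbove
    refine ⟨r + 1, fun w hw => ?_⟩
    by_contra hP
    have := hr ⟨w, hP, rfl⟩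
    omega
  · rintro ⟨r, hr⟩
    refine (finite_supN_le r).subset fun w hw => ?_
    by_contra h
    simp only [Set.mem_ofPred_eq, not_le] at h
    exact hw (hr w h.le)

instance : (Bornology.cobounded (ℤ × ℤ)).NeBot := by
  rw [cobounded_eq_cofinite]; infer_instance

theorem sqN_add_le (v w : ℤ × ℤ) : sqN (v + w) ≤ 2 * sqN v + 2 * sqN w := by
  simp only [sqN, Prod.fst_add, Prod.snd_add]
  nlinarith [sq_nonneg (v.1 - w.1), sq_nonneg (v.2 - w.2)]

theorem sqN_pos {w : ℤ × ℤ} (hw : w ≠ 0) : 1 ≤ sqN w := by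
  have := sqN_nonneg w
  by_contra h
  exact hw (sqN_eq_zero (by omega))

theorem log_quarter_le_logDown {w : ℤ × ℤ} (hw : w ≠ 0) : Real.log (sqN w / 4) ≤ logDown w := by
  have h := sqN_pos hw
  have h' : (1 : ℝ) ≤ sqN w := by exact_mod_cast h
  apply Real.log_le_log (by linarith)
  unfold logDownArg
  split_ifs with h1 h2
  · omega
  · rw [h2]; norm_num
  · have : (2 : ℝ) ≤ sqN w := by exact_mod_cast (by omega : 2 ≤ sqN w)
    linarith

/-- The growth at infinity cancels. This gives the upper bound that `comparison` requires on
unbounded domains. -/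
theorem logUp_sub_logDown_le (p q w : ℤ × ℤ) (hw : w ≠ q) :
    logUp (w - p) - logDown (w - q) ≤ Real.log (4 * (5 / 2 + 2 * sqN (q - p))) := by
  have h0 : w - q ≠ 0 := sub_ne_zero.mpr hw
  have h1 := log_quarter_le_logDown h0
  have h2 : (1 : ℝ) ≤ sqN (w - q) := by exact_mod_cast sqN_pos h0
  have h3 : (sqN (w - p) : ℝ) ≤ 2 * sqN (w - q) + 2 * sqN (q - p) := by
    have := sqN_add_le (w - q) (q - p)
    rw [sub_add_sub_cancel] at this
    exact_mod_cast this
  have h4 : (0 : ℝ) ≤ sqN (q - p) := by exact_mod_cast sqN_nonneg _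
  have h5 : (0 : ℝ) ≤ sqN (w - p) := by exact_mod_cast sqN_nonneg _
  have h6 : logUp (w - p) ≤ Real.log (4 * (5 / 2 + 2 * sqN (q - p)) * (sqN (w - q) / 4)) := by
    apply Real.log_le_log (by linarith)
    nlinarith
  rw [Real.log_mul (by positivity) (by positivity)] at h6
  linarith

theorem logUp_le {w : ℤ × ℤ} {s : ℤ} (hw : supN w ≤ s) :
    logUp w ≤ Real.log (2 * (s : ℝ) ^ 2 + 1 / 2) := by
  have h0 : (0 : ℝ) ≤ sqN w := by exact_mod_cast sqN_nonneg w
  apply Real.log_le_log (by linarith)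
  have h1 : sqN w ≤ 2 * s ^ 2 := (sqN_le_two_mul_supN_sq w).trans
    (by have := pow_le_pow_left₀ (supN_nonneg w) hw 2; omega)
  have : (sqN w : ℝ) ≤ 2 * (s : ℝ) ^ 2 := by exact_mod_cast h1
  linarith

theorem le_logUp {w : ℤ × ℤ} {s : ℤ} (hs : 1 ≤ s) (hw : s ≤ supN w) :
    Real.log ((s : ℝ) ^ 2) ≤ logUp w := by
  have h1 : s ^ 2 ≤ sqN w := (pow_le_pow_left₀ (by omega) hw 2).trans (supN_sq_le_sqN w)
  have h2 : ((s : ℝ)) ^ 2 ≤ sqN w := by exact_mod_cast h1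
  have h3 : (1 : ℝ) ≤ s := by exact_mod_cast hs
  apply Real.log_le_log (by positivity)
  linarith

theorem supN_add_unit {w e : ℤ × ℤ} (he : e ∈ unitSteps) :
    supN (w + e) ≤ supN w + 1 ∧ supN w ≤ supN (w + e) + 1 := by
  have h1 := supN_add_le w e
  have h2 := supN_add_le (w + e) (-e)
  rw [supN_neg, add_neg_cancel_right] at h2
  rw [supN_unitSteps he] at h1 h2
  exact ⟨h1, h2⟩

/-- Far points are seen from each other: a nonnegative function that is superharmonic outside a box
is, at every point further away than a given far point `p`, at least a quarter of its value at
`p`. -/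
theorem quarter_le_of_superharmonic {u : ℤ × ℤ → ℝ} {r : ℤ} (hr : 1 ≤ r)
    (h0 : ∀ w, r ≤ supN w → 0 ≤ u w) (hs : ∀ w, r < supN w → nbrAvg u w ≤ u w)
    {p z : ℤ × ℤ} (hp : 1000000 * r ^ 2 ≤ supN p) (hz : supN p ≤ supN z) : u p / 4 ≤ u z := by
  by_cases hzp : z = p
  · subst hzp
    have := h0 z (by nlinarith)
    linarith
  have hup := h0 p (by nlinarith)
  set P : ℤ := supN p with hP
  have hrP : 1000000 * r ≤ P := by nlinarith
  have hr' : (1 : ℝ) ≤ r := by exact_mod_cast hr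
  have hP' : 1000000 * (r : ℝ) ≤ P := by exact_mod_cast hrP
  have hP2 : 1000000 * (r : ℝ) ^ 2 ≤ P := by exact_mod_cast hp
  set X : ℝ := ((P - r : ℤ) : ℝ) ^ 2 - 1 with hX
  set Y : ℝ := 2 * (r : ℝ) ^ 2 + 1 / 2 with hY
  have hXl : (P : ℝ) ^ 2 / 2 ≤ X := by rw [hX]; push_cast; nlinarith
  have hXpos : 0 < X := lt_of_lt_of_le (by nlinarith) hXl
  have hYpos : 0 < Y := by positivity
  have hYu : Y ≤ 3 * (r : ℝ) ^ 2 := by rw [hY]; nlinarith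
  -- Chosen so that φ below, a Green-type function with pole at p, is nonpositive on the box of
  -- radius r: there `logUp` is at most log Y and `logDown` centred at p is at least log X.
  set α : ℝ := Real.log X - Real.log Y with hα
  set φ : ℤ × ℤ → ℝ := fun w => α + logUp w - logDown (w - p) with hφ
  have hφp : φ p ≤ α + Real.log (2 * (P : ℝ) ^ 2 + 1 / 2) + Real.log 768 := by
    have h1 := logUp_le (w := p) (s := P) le_rfl
    have h2 := neg_log_le_logDown (p - p)
    simp only [hφ]; linarith
  -- The left side bounds φ(p), and α - log 8 is a lower bound for φ(z) because |z - p| ≤ 2|z|.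
  -- Their ratio gives the quarter; up to constants the inequality says P⁴ ≥ r⁶, whence the
  -- largeness of P.
  have key : α + Real.log (2 * (P : ℝ) ^ 2 + 1 / 2) + Real.log 768 ≤ 4 * (α - Real.log 8) := by
    have h1 : Real.log ((2 * (P : ℝ) ^ 2 + 1 / 2) * 768 * 8 ^ 4 * Y ^ 3) ≤ Real.log (X ^ 3) := by
      apply Real.log_le_log (by positivity)
      have hA : 2 * (P : ℝ) ^ 2 + 1 / 2 ≤ 3 * (P : ℝ) ^ 2 := by nlinarith
      have hB : Y ^ 3 ≤ (3 * (r : ℝ) ^ 2) ^ 3 := pow_le_pow_left₀ hYpos.le hYu 3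
      have hC : ((P : ℝ) ^ 2 / 2) ^ 3 ≤ X ^ 3 := pow_le_pow_left₀ (by positivity) hXl 3
      refine le_trans ?_ hC
      have hD : (2 * (P : ℝ) ^ 2 + 1 / 2) * 768 * 8 ^ 4 * Y ^ 3 ≤
          3 * (P : ℝ) ^ 2 * 768 * 8 ^ 4 * (3 * (r : ℝ) ^ 2) ^ 3 := by gcongr
      refine hD.trans ?_
      have hE : (1000000 * (r : ℝ) ^ 2) ^ 4 ≤ (P : ℝ) ^ 4 := pow_le_pow_left₀ (by positivity) hP2 4
      have hF : (r : ℝ) ^ 6 ≤ r ^ 8 := pow_le_pow_right₀ hr' (by norm_num)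
      have hG : 3 * 768 * 8 ^ 4 * 27 * (r : ℝ) ^ 6 ≤ (P : ℝ) ^ 4 / 8 := by nlinarith
      have := mul_le_mul_of_nonneg_left hG (sq_nonneg (P : ℝ))
      nlinarith
    rw [Real.log_mul (by positivity) (by positivity), Real.log_mul (by positivity) (by positivity),
      Real.log_mul (by positivity) (by positivity), Real.log_pow, Real.log_pow, Real.log_pow] at h1
    push_cast at h1
    rw [hα]; linarith
  have hφppos : 0 < φ p := by
    have h1 : 0 ≤ α := by
      rw [hα, sub_nonneg]
      exact Real.log_le_log hYpos (by nlinarith)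
    have h2 := le_logUp (w := p) (s := P) (by omega) le_rfl
    have h3 : logDown (p - p) = -Real.log 768 := by simp [logDown, sqN, logDownArg]
    have h4 : 0 ≤ Real.log ((P : ℝ) ^ 2) := Real.log_nonneg (by nlinarith)
    have h5 : 0 < Real.log 768 := Real.log_pos (by norm_num)
    simp only [hφ, h3]; linarith
  have hφz : α - Real.log 8 ≤ φ z := by
    have h1 := le_logUp (w := z) (s := supN z) (by omega) le_rfl
    have h2 : logDown (z - p) ≤ Real.log (2 * ((2 * supN z : ℤ) : ℝ) ^ 2) := by
      apply logDown_le_of_supN_le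
      · have := supN_nonneg (z - p)
        by_contra h
        exact hzp (sub_eq_zero.mp (eq_zero_of_supN (by omega)))
      · have := supN_add_le z (-p)
        rw [supN_neg, ← sub_eq_add_neg] at this
        omega
    have h3 : 2 * ((2 * supN z : ℤ) : ℝ) ^ 2 = 8 * (supN z : ℝ) ^ 2 := by push_cast; ring
    have h4 : (1 : ℝ) ≤ supN z := by exact_mod_cast (by omega : 1 ≤ supN z)
    rw [h3, Real.log_mul (by norm_num) (by positivity)] at h2
    simp only [hφ]; linarith
  have hcmp := comparison (Ω := {w | r < supN w ∧ w ≠ p}) ⟨p, fun h => h.2 rfl⟩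
    (φ := fun w => u p / φ p * φ w) (F := u)
    (C := u p / φ p * (α + Real.log (4 * (5 / 2 + 2 * sqN (p - 0)))))
    (fun w hw => by
      have := logUp_sub_logDown_le 0 p w hw.2
      rw [sub_zero] at this
      apply mul_le_mul_of_nonneg_left _ (by positivity)
      simp only [hφ]; linarith)
    (fun w hw => h0 w hw.1.le)
    (fun w hw => by
      have h1 : nbrAvg (fun w => u p / φ p * φ w) w = u p / φ p * nbrAvg φ w := by
        unfold nbrAvg; ring
      rw [h1]
      apply mul_le_mul_of_nonneg_left _ (by positivity)
      have h2 : nbrAvg φ w = α + nbrAvg logUp w - nbrAvg logDown (w - p) := by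
        rw [← nbrAvg_comp_sub]; unfold nbrAvg; simp only [hφ]; ring
      rw [h2]
      have := logUp_subharmonic w
      have := logDown_superharmonic (sub_ne_zero.mpr hw.2)
      simp only [hφ]; linarith)
    (fun w hw => hs w hw.1)
    (fun w hw e he hne => by
      by_cases hep : w + e = p
      · rw [hep]; field_simp; exact le_rfl
      · have h1 : supN (w + e) = r := by
          have h2 : ¬ r < supN (w + e) := fun h => hne ⟨h, hep⟩
          have := (supN_add_unit (w := w) he).2
          have := hw.1
          omega
        refine le_trans ?_ (h0 (w + e) h1.ge)
        apply mul_nonpos_of_nonneg_of_nonpos (by positivity)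
        have h2 := logUp_le h1.le
        have h3 : Real.log X ≤ logDown (w + e - p) := by
          apply log_le_logDown (by omega)
          rw [supN_sub_comm]
          have := le_supN_sub p (w + e)
          omega
        simp only [hφ]; linarith)
    z ⟨by nlinarith, hzp⟩
  refine le_trans ?_ hcmp
  have : φ p / 4 ≤ φ z := by linarith
  calc u p / 4 = u p / φ p * (φ p / 4) := by field_simp
    _ ≤ u p / φ p * φ z := mul_le_mul_of_nonneg_left this (by positivity)

/-- A bounded function that is harmonic outside a box has a limit at infinity. -/
theorem exists_tendsto_of_harmonic {F : ℤ × ℤ → ℝ} {r : ℤ} (h0 : ∀ w, 0 ≤ F w)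
    (h1 : ∀ w, F w ≤ 1) (hh : ∀ w, r < supN w → F w = nbrAvg F w) :
    ∃ L, Tendsto F (Bornology.cobounded (ℤ × ℤ)) (𝓝 L) := by
  set l := Bornology.cobounded (ℤ × ℤ)
  have hbu : IsBoundedUnder (· ≤ ·) l F := isBoundedUnder_of ⟨1, h1⟩
  have hbl : IsBoundedUnder (· ≥ ·) l F := isBoundedUnder_of ⟨0, h0⟩
  refine ⟨limsup F l, tendsto_of_liminf_eq_limsup ?_ rfl hbu hbl⟩
  apply le_antisymm (liminf_le_limsup hbu hbl)
  by_contra hlt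
  push Not at hlt
  set I := liminf F l
  set S := limsup F l
  -- At p the function F - (I - ε) exceeds S - I = 16ε. A quarter of this is 4ε, so F ≥ I + 3ε at
  -- all far points, against the definition of I.
  set ε := (S - I) / 16 with hε
  have hεpos : 0 < ε := by rw [hε]; linarith
  have hI : ∀ᶠ w in l, I - ε < F w := eventually_lt_of_lt_liminf (by linarith) hbl
  have hS : ∃ᶠ w in l, S - ε < F w :=
    frequently_lt_of_lt_limsup hbl.isCoboundedUnder_flip (by linarith)
  obtain ⟨r₁, hr₁⟩ := eventually_cobounded_iff.mp hI
  set R : ℤ := max (max r r₁) 1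
  have hfar : ∀ᶠ w in l, 1000000 * R ^ 2 ≤ supN w := eventually_cobounded_iff.mpr ⟨_, fun w h => h⟩
  obtain ⟨p, hp1, hp2⟩ := (hS.and_eventually hfar).exists
  have hlow : ∀ᶠ z in l, I + ε ≤ F z := by
    refine eventually_cobounded_iff.mpr ⟨supN p, fun z hz => ?_⟩
    have := quarter_le_of_superharmonic (u := fun w => F w - (I - ε)) (r := R) (by omega)
      (fun w hw => by linarith [hr₁ w (by omega)])
      (fun w hw => by
        have := hh w (by omega)
        rw [this]; unfold nbrAvg; linarith) hp2 hz
    have : (S - I) = 16 * ε := by rw [hε]; ring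
    linarith
  have := le_liminf_of_le (hbu.isCoboundedUnder_flip) hlow
  change I + ε ≤ I at this
  linarith

/-! ### Lower bounds across obstacle-free boxes and annuli. -/

/-- If `F ≥ 0` is superharmonic off `A`, then a lower bound on a box far from `A` extends to the box
of twice the size at the cost of a constant factor. -/
theorem ball_step {A : Finset (ℤ × ℤ)} {F : ℤ × ℤ → ℝ} (h0 : ∀ w, 0 ≤ F w)
    (hs : ∀ w, w ∉ A → nbrAvg F w ≤ F w) {p : ℤ × ℤ} {ρ : ℤ} {μ : ℝ} (hρ : 2 ≤ ρ) (hμ : 0 ≤ μ)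
    (hA : ∀ a ∈ A, 4 * ρ ≤ supN (a - p)) (hF : ∀ w, supN (w - p) ≤ ρ → μ ≤ F w) :
    ∀ w, supN (w - p) ≤ 2 * ρ → μ / 6 ≤ F w := by
  intro z hz
  by_cases hzρ : supN (z - p) ≤ ρ
  · linarith [hF z hzρ]
  push Not at hzρ
  have hρ' : (2 : ℝ) ≤ ρ := by exact_mod_cast hρ
  have hlog2 : 0 < Real.log 2 := Real.log_pos (by norm_num)
  -- The barrier κ(β - `logDown`) is nonpositive from radius 4ρ on, and κ makes it at most μ at
  -- radius ρ. Up to radius 2ρ it keeps a fraction log(15/8) / (5 log 2) ≥ 1/6.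
  set β : ℝ := Real.log (16 * (ρ : ℝ) ^ 2 - 1) with hβ
  set κ : ℝ := μ / (5 * Real.log 2) with hκ
  have hκ0 : 0 ≤ κ := by positivity
  have hcmp := comparison (Ω := {w | ρ < supN (w - p) ∧ supN (w - p) < 4 * ρ})
    ⟨p, fun h => by have := h.1; simp [supN] at this; omega⟩
    (φ := fun w => κ * (β - logDown (w - p))) (F := F)
    (C := κ * (β + Real.log 768))
    (fun w hw => by
      have := neg_log_le_logDown (w - p)
      apply mul_le_mul_of_nonneg_left _ hκ0
      linarith)
    (fun w _ => h0 w)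
    (fun w hw => by
      have h1 : nbrAvg (fun w => κ * (β - logDown (w - p))) w =
          κ * (β - nbrAvg logDown (w - p)) := by
        rw [← nbrAvg_comp_sub]; unfold nbrAvg; ring
      rw [h1]
      apply mul_le_mul_of_nonneg_left _ hκ0
      have := logDown_superharmonic (w := w - p) (fun h => by
        have := hw.1; rw [h] at this; simp [supN] at this; omega)
      linarith)
    (fun w hw => hs w fun h => by have := hA w h; have := hw.2; omega)
    (fun w hw e he hne => by
      have h1 := supN_add_unit (w := w - p) he
      rw [sub_add_eq_add_sub] at h1
      have hw1 := hw.1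
      have hw2 := hw.2
      by_cases h2 : supN (w + e - p) ≤ ρ
      · refine le_trans ?_ (hF _ h2)
        have h3 := log_le_logDown hρ (by omega : ρ ≤ supN (w + e - p))
        have h4 : β ≤ 5 * Real.log 2 + Real.log ((ρ : ℝ) ^ 2 - 1) := by
          rw [← Nat.cast_ofNat (R := ℝ) (n := 5), ← Real.log_pow,
            ← Real.log_mul (by norm_num) (by nlinarith)]
          apply Real.log_le_log (by nlinarith)
          nlinarith
        calc κ * (β - logDown (w + e - p)) ≤ κ * (5 * Real.log 2) :=
              mul_le_mul_of_nonneg_left (by linarith) hκ0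
          _ = μ := by rw [hκ]; field_simp
      · have h3 : 4 * ρ ≤ supN (w + e - p) := by
          by_contra h
          exact hne ⟨by omega, by omega⟩
        refine le_trans ?_ (h0 _)
        have h4 := log_le_logDown (by omega) h3
        have h5 : (((4 * ρ : ℤ) : ℝ) ^ 2 - 1) = 16 * (ρ : ℝ) ^ 2 - 1 := by push_cast; ring
        rw [h5] at h4
        exact mul_nonpos_of_nonneg_of_nonpos hκ0 (by linarith))
    z ⟨hzρ, by omega⟩
  refine le_trans ?_ hcmp
  have h1 := logDown_le_of_supN_le (by omega : 1 ≤ supN (z - p)) hz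
  have h3 : Real.log (2 * ((2 * ρ : ℤ) : ℝ) ^ 2) + Real.log (15 / 8) ≤ β := by
    push_cast
    rw [← Real.log_mul (by positivity) (by norm_num)]
    apply Real.log_le_log (by positivity)
    nlinarith
  have h4 : 5 * Real.log 2 ≤ 6 * Real.log (15 / 8) := by
    rw [← Nat.cast_ofNat (R := ℝ) (n := 5), ← Nat.cast_ofNat (R := ℝ) (n := 6), ← Real.log_pow,
      ← Real.log_pow]
    exact Real.log_le_log (by norm_num) (by norm_num)
  calc μ / 6 = κ * (5 * Real.log 2 / 6) := by rw [hκ]; field_simp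
    _ ≤ κ * (β - logDown (z - p)) := mul_le_mul_of_nonneg_left (by linarith) hκ0

/-- A lower bound on the boundary of a box extends across a wide annulus free of obstacles, at the
cost of the logarithm of its aspect ratio. -/
theorem annulus_step_log {A : Finset (ℤ × ℤ)} {F : ℤ × ℤ → ℝ} (h0 : ∀ w, 0 ≤ F w)
    (hs : ∀ w, w ∉ A → nbrAvg F w ≤ F w) {t d : ℤ} {μ Λ : ℝ} (ht : 2 ≤ t) (hd : 64 * t ≤ d)
    (hμ : 0 ≤ μ) (hΛ : Real.log ((d : ℝ) ^ 2 / (t : ℝ) ^ 2) ≤ Λ)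
    (hA : ∀ a ∈ A, supN a ≤ t ∨ d ≤ supN a) (hF : ∀ w, supN w = t → μ ≤ F w) :
    ∀ w, t ≤ supN w → 2 * supN w ≤ d → μ * (1 / 2) / (Λ + 1) ≤ F w := by
  intro z hz1 hz2
  have ht' : (2 : ℝ) ≤ t := by exact_mod_cast ht
  have hd' : 64 * (t : ℝ) ≤ d := by exact_mod_cast hd
  have hd0 : 0 < (d : ℝ) := by linarith
  have hΛ0 : 0 ≤ Λ := le_trans (Real.log_nonneg (by
    rw [one_le_div (by positivity)]; nlinarith)) hΛ
  rcases hz1.eq_or_lt with hz1 | hz1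
  · refine le_trans ?_ (hF z hz1.symm)
    rw [div_le_iff₀ (by linarith)]
    nlinarith
  set β : ℝ := Real.log ((d : ℝ) ^ 2 - 1) with hβ
  set κ : ℝ := μ / (Λ + 1) with hκ
  have hκ0 : 0 ≤ κ := by positivity
  have hcmp := comparison (Ω := {w | t < supN w ∧ supN w < d})
    ⟨0, fun h => by have := h.1; simp [supN] at this; omega⟩
    (φ := fun w => κ * (β - logDown w)) (F := F)
    (C := κ * (β + Real.log 768))
    (fun w hw => by
      have := neg_log_le_logDown w
      apply mul_le_mul_of_nonneg_left _ hκ0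
      linarith)
    (fun w _ => h0 w)
    (fun w hw => by
      have h1 : nbrAvg (fun w => κ * (β - logDown w)) w = κ * (β - nbrAvg logDown w) := by
        unfold nbrAvg; ring
      rw [h1]
      apply mul_le_mul_of_nonneg_left _ hκ0
      have := logDown_superharmonic (w := w) (fun h => by
        have := hw.1; rw [h] at this; simp [supN] at this; omega)
      linarith)
    (fun w hw => hs w fun h => by have := hA w h; have := hw.1; have := hw.2; omega)
    (fun w hw e he hne => by
      have h1 := supN_add_unit (w := w) he
      have hw1 := hw.1
      have hw2 := hw.2
      by_cases h2 : supN (w + e) ≤ t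
      · refine le_trans ?_ (hF _ (by omega))
        have h3 := log_le_logDown ht (by omega : t ≤ supN (w + e))
        have h4 : β ≤ Real.log ((d : ℝ) ^ 2 / (t : ℝ) ^ 2) + Real.log 2 +
            Real.log ((t : ℝ) ^ 2 - 1) := by
          rw [← Real.log_mul (by positivity) (by norm_num),
            ← Real.log_mul (by positivity) (by nlinarith)]
          apply Real.log_le_log (by nlinarith)
          have : (1 : ℝ) ≤ 2 * ((t : ℝ) ^ 2 - 1) / (t : ℝ) ^ 2 := by
            rw [one_le_div (by positivity)]; nlinarith
          calc (d : ℝ) ^ 2 - 1 ≤ (d : ℝ) ^ 2 * 1 := by linarith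
            _ ≤ (d : ℝ) ^ 2 * (2 * ((t : ℝ) ^ 2 - 1) / (t : ℝ) ^ 2) := by gcongr
            _ = _ := by ring
        have h5 : Real.log 2 ≤ 1 := by have := Real.log_two_lt_d9; linarith
        calc κ * (β - logDown (w + e)) ≤ κ * (Λ + 1) :=
              mul_le_mul_of_nonneg_left (by linarith) hκ0
          _ = μ := by rw [hκ]; field_simp
      · have h3 : d ≤ supN (w + e) := by
          by_contra h
          exact hne ⟨by omega, by omega⟩
        refine le_trans ?_ (h0 _)
        have h4 := log_le_logDown (by omega) h3
        exact mul_nonpos_of_nonneg_of_nonpos hκ0 (by linarith))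
    z ⟨hz1, by omega⟩
  refine le_trans ?_ hcmp
  have h1 := logDown_le_of_supN_le (by omega : 1 ≤ supN z) le_rfl
  have hzd : 2 * (supN z : ℝ) ≤ d := by exact_mod_cast hz2
  have hz0 : (1 : ℝ) ≤ supN z := by exact_mod_cast (by omega : 1 ≤ supN z)
  have h3 : Real.log (2 * (supN z : ℝ) ^ 2) + Real.log (7 / 4) ≤ β := by
    rw [← Real.log_mul (by positivity) (by norm_num)]
    apply Real.log_le_log (by positivity)
    nlinarith
  have h4 : 1 / 2 ≤ Real.log (7 / 4) := by
    have h5 : 2 * Real.log (7 / 4) = Real.log ((7 / 4) ^ 2) := by rw [Real.log_pow]; norm_num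
    have h6 : 1 ≤ Real.log ((7 / 4 : ℝ) ^ 2) := by
      rw [Real.le_log_iff_exp_le (by norm_num)]
      have := Real.exp_one_lt_d9
      norm_num
      linarith
    linarith
  calc μ * (1 / 2) / (Λ + 1) = κ * (1 / 2) := by rw [hκ]; ring
    _ ≤ κ * (β - logDown z) := mul_le_mul_of_nonneg_left (by linarith) hκ0

/-- Green's function comparison for a point `y` outside a box of radius `t`, up to an additive
constant. -/
noncomputable def greenBound (t : ℤ) (y w : ℤ × ℤ) : ℝ :=
  logDown w + Real.log (4 * (supN y : ℝ) ^ 2) - logUp (w - y) - Real.log ((t : ℝ) ^ 2 - 1)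

/-- `greenBound t y w` is about 2 log(|w||y| / (t|w - y|)), and it is superharmonic in w off the
origin. Its sum over far obstacles y bounds the chance of meeting one of them before the ring of
radius t. The four estimates control it on the ring, at the obstacles, at the pole and in the inner
part of the annulus. -/
theorem greenBound_nonneg_of_ring {t : ℤ} {y w : ℤ × ℤ} (ht : 2 ≤ t) (hw : supN w = t)
    (hy : 64 * t ≤ supN y) : 0 ≤ greenBound t y w := by
  have h1 := log_le_logDown ht hw.ge
  have h2 : supN (w - y) ≤ supN y + t := by
    have := supN_add_le w (-y)
    rw [supN_neg, ← sub_eq_add_neg] at this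
    omega
  have h3 := logUp_le h2
  have ht' : (2 : ℝ) ≤ t := by exact_mod_cast ht
  have hy' : 64 * (t : ℝ) ≤ supN y := by exact_mod_cast hy
  have h4 : Real.log (2 * ((supN y + t : ℤ) : ℝ) ^ 2 + 1 / 2) ≤
      Real.log (4 * (supN y : ℝ) ^ 2) := by
    push_cast
    apply Real.log_le_log (by positivity)
    nlinarith
  unfold greenBound
  linarith

theorem le_greenBound_of_ne {t d : ℤ} {y w : ℤ × ℤ} (ht : 2 ≤ t) (hd : 64 * t ≤ d)
    (hw : d ≤ supN w) (hy : d ≤ supN y) :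
    Real.log ((d : ℝ) ^ 2 / (t : ℝ) ^ 2) - Real.log 5 ≤ greenBound t y w := by
  have h1 := log_le_logDown (s := supN w) (w := w) (by omega) le_rfl
  have h2 : supN (w - y) ≤ supN w + supN y := by
    have := supN_add_le w (-y)
    rwa [supN_neg, ← sub_eq_add_neg] at this
  have h3 := logUp_le h2
  have ht' : (2 : ℝ) ≤ t := by exact_mod_cast ht
  have hd' : 64 * (t : ℝ) ≤ d := by exact_mod_cast hd
  have hy' : (d : ℝ) ≤ supN y := by exact_mod_cast hy
  have hw' : (d : ℝ) ≤ supN w := by exact_mod_cast hw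
  push_cast at h3
  unfold greenBound
  generalize (supN w : ℝ) = a at *
  generalize (supN y : ℝ) = b at *
  generalize (t : ℝ) = t at *
  generalize (d : ℝ) = d at *
  have h4 : Real.log ((d ^ 2 / t ^ 2) * (2 * (a + b) ^ 2 + 1 / 2) * (t ^ 2 - 1)) ≤
      Real.log (5 * (a ^ 2 - 1) * (4 * b ^ 2)) := by
    apply Real.log_le_log
    · have : 0 < t ^ 2 - 1 := by nlinarith
      have : 0 < d := by linarith
      positivity
    · have e1 : (t ^ 2 - 1) / t ^ 2 ≤ 1 := by rw [div_le_one (by positivity)]; linarith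
      have e2 : d ^ 2 * (2 * (a + b) ^ 2 + 1 / 2) ≤ 5 * (a ^ 2 - 1) * (4 * b ^ 2) := by
        have a1 : d ^ 2 ≤ a ^ 2 := pow_le_pow_left₀ (by linarith) hw' 2
        have a2 : d ^ 2 ≤ b ^ 2 := pow_le_pow_left₀ (by linarith) hy' 2
        have a3 : (a + b) ^ 2 ≤ 2 * a ^ 2 + 2 * b ^ 2 := by nlinarith [sq_nonneg (a - b)]
        have a4 : 128 ≤ d := by linarith
        have a5 : 128 ^ 2 ≤ d ^ 2 := pow_le_pow_left₀ (by norm_num) a4 2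
        have a6 := mul_le_mul_of_nonneg_right a1 (sq_nonneg b)
        have a7 := mul_le_mul_of_nonneg_right a2 (sq_nonneg a)
        have a8 := mul_le_mul_of_nonneg_left a3 (sq_nonneg d)
        have a9 := mul_le_mul_of_nonneg_right (a5.trans a1) (sq_nonneg b)
        nlinarith
      calc d ^ 2 / t ^ 2 * (2 * (a + b) ^ 2 + 1 / 2) * (t ^ 2 - 1)
          = d ^ 2 * (2 * (a + b) ^ 2 + 1 / 2) * ((t ^ 2 - 1) / t ^ 2) := by ring
        _ ≤ d ^ 2 * (2 * (a + b) ^ 2 + 1 / 2) * 1 := by gcongr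
        _ ≤ _ := by linarith
  have p1 : 0 < t ^ 2 - 1 := by nlinarith
  have p2 : 0 < d := by linarith
  have p3 : 0 < a ^ 2 - 1 := by nlinarith
  have p4 : 0 < b := by linarith
  have p5 : 0 < a := by linarith
  rw [Real.log_mul (by positivity) p1.ne', Real.log_mul (by positivity) (by positivity),
    Real.log_mul (by positivity) (by positivity), Real.log_mul (by norm_num) p3.ne'] at h4
  linarith

/-- At the pole `logUp` is bounded, which doubles the main term log(d²/t²) of the other estimates.
This surplus is what makes `annulus_step` independent of the width. -/
theorem le_greenBound_self {t d : ℤ} {y : ℤ × ℤ} (ht : 2 ≤ t) (hd : 64 * t ≤ d)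
    (hy : d ≤ supN y) :
    2 * Real.log ((d : ℝ) ^ 2 / (t : ℝ) ^ 2) ≤ greenBound t y y := by
  have h1 := log_le_logDown (s := supN y) (w := y) (by omega) le_rfl
  have h3 : logUp (y - y) = Real.log (1 / 2) := by simp [logUp, sqN]
  have ht' : (2 : ℝ) ≤ t := by exact_mod_cast ht
  have hd' : 64 * (t : ℝ) ≤ d := by exact_mod_cast hd
  have hy' : (d : ℝ) ≤ supN y := by exact_mod_cast hy
  unfold greenBound
  rw [h3]
  generalize (supN y : ℝ) = b at *
  generalize (t : ℝ) = t at *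
  generalize (d : ℝ) = d at *
  have p1 : 0 < t ^ 2 - 1 := by nlinarith
  have p2 : 0 < d := by linarith
  have p3 : 0 < b ^ 2 - 1 := by nlinarith
  have p4 : 0 < b := by linarith
  have h4 : Real.log ((d ^ 2 / t ^ 2) ^ 2 * (1 / 2) * (t ^ 2 - 1)) ≤
      Real.log ((b ^ 2 - 1) * (4 * b ^ 2)) := by
    apply Real.log_le_log (by positivity)
    have e1 : (t ^ 2 - 1) / t ^ 4 ≤ 1 := by
      rw [div_le_one (by positivity)]; nlinarith [sq_nonneg (t ^ 2 - 1)]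
    have a2 : d ^ 2 ≤ b ^ 2 := pow_le_pow_left₀ (by linarith) hy' 2
    calc (d ^ 2 / t ^ 2) ^ 2 * (1 / 2) * (t ^ 2 - 1)
        = d ^ 4 * (1 / 2) * ((t ^ 2 - 1) / t ^ 4) := by field_simp
      _ ≤ d ^ 4 * (1 / 2) * 1 := by gcongr
      _ ≤ (b ^ 2 - 1) * (4 * b ^ 2) := by
        have : 1 ≤ b ^ 2 := by nlinarith
        have := mul_le_mul a2 a2 (sq_nonneg d) (sq_nonneg b)
        have : 128 ≤ b := by linarith
        have : b ≤ b ^ 2 := by nlinarith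
        nlinarith
  rw [Real.log_mul (by positivity) p1.ne', Real.log_mul (by positivity) (by positivity),
    Real.log_mul p3.ne' (by positivity), Real.log_pow] at h4
  push_cast at h4
  linarith

theorem greenBound_le {t d : ℤ} {y z : ℤ × ℤ} (ht : 2 ≤ t) (hd : 64 * t ≤ d)
    (hy : d ≤ supN y) (hz1 : t ≤ supN z) (hz2 : 2 * supN z ≤ d) :
    greenBound t y z ≤ Real.log ((d : ℝ) ^ 2 / (t : ℝ) ^ 2) + Real.log 16 := by
  have h1 := logDown_le_of_supN_le (by omega : 1 ≤ supN z) le_rfl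
  have h2 : supN y - supN z ≤ supN (z - y) := by
    rw [supN_sub_comm]; exact le_supN_sub _ _
  have h3 := le_logUp (by omega) h2
  have ht' : (2 : ℝ) ≤ t := by exact_mod_cast ht
  have hd' : 64 * (t : ℝ) ≤ d := by exact_mod_cast hd
  have hy' : (d : ℝ) ≤ supN y := by exact_mod_cast hy
  have hz1' : (t : ℝ) ≤ supN z := by exact_mod_cast hz1
  have hz2' : 2 * (supN z : ℝ) ≤ d := by exact_mod_cast hz2
  push_cast at h3
  unfold greenBound
  generalize (supN y : ℝ) = b at *
  generalize (supN z : ℝ) = c at *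
  generalize (t : ℝ) = t at *
  generalize (d : ℝ) = d at *
  have p1 : 0 < t ^ 2 - 1 := by nlinarith
  have p2 : 0 < d := by linarith
  have p3 : 0 < b - c := by linarith
  have p4 : 0 < b := by linarith
  have p5 : 0 < c := by linarith
  have h4 : Real.log ((2 * c ^ 2) * (4 * b ^ 2)) ≤
      Real.log ((d ^ 2 / t ^ 2) * 16 * (b - c) ^ 2 * (t ^ 2 - 1)) := by
    apply Real.log_le_log (by positivity)
    have e1 : 1 / 2 ≤ (t ^ 2 - 1) / t ^ 2 := by
      rw [div_le_div_iff₀ (by norm_num) (by positivity)]; nlinarith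
    have e2 : b ^ 2 ≤ 4 * (b - c) ^ 2 := by
      have : b ≤ 2 * (b - c) := by linarith
      nlinarith
    have e3 : 4 * c ^ 2 ≤ d ^ 2 := by nlinarith
    calc (2 * c ^ 2) * (4 * b ^ 2) = (4 * c ^ 2) * (2 * b ^ 2) := by ring
      _ ≤ d ^ 2 * (2 * (4 * (b - c) ^ 2)) := by gcongr
      _ = d ^ 2 * 16 * (b - c) ^ 2 * (1 / 2) := by ring
      _ ≤ d ^ 2 * 16 * (b - c) ^ 2 * ((t ^ 2 - 1) / t ^ 2) := by gcongr
      _ = _ := by ring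
  rw [Real.log_mul (x := 2 * c ^ 2) (y := 4 * b ^ 2) (by positivity) (by positivity),
    Real.log_mul (x := d ^ 2 / t ^ 2 * 16 * (b - c) ^ 2) (by positivity) p1.ne',
    Real.log_mul (x := d ^ 2 / t ^ 2 * 16) (by positivity) (by positivity),
    Real.log_mul (x := d ^ 2 / t ^ 2) (by positivity) (by norm_num)] at h4
  linarith

/-- A lower bound on the boundary of a box extends across an annulus free of obstacles, however
wide, at a cost depending only on the number of obstacles. -/
theorem annulus_step {A : Finset (ℤ × ℤ)} {F : ℤ × ℤ → ℝ} (h0 : ∀ w, 0 ≤ F w)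
    (hs : ∀ w, w ∉ A → nbrAvg F w ≤ F w) {n : ℕ} (hn : 1 ≤ n) (hAn : A.card ≤ n) {t d : ℤ} {μ : ℝ}
    (ht : 2 ≤ t) (hd : 64 * t ≤ d) (hμ : 0 ≤ μ)
    (hA : ∀ a ∈ A, supN a ≤ t ∨ d ≤ supN a) (hF : ∀ w, supN w = t → μ ≤ F w) :
    ∀ w, t ≤ supN w → 2 * supN w ≤ d → μ / (22 * n) ≤ F w := by
  have hn' : (1 : ℝ) ≤ n := by exact_mod_cast hn
  set Λ : ℝ := Real.log ((d : ℝ) ^ 2 / (t : ℝ) ^ 2) with hΛ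
  -- When Λ ≤ 10n, the cost 2(Λ + 1) of `annulus_step_log` is already at most 22n. Otherwise the
  -- constants log 5 and log 16, summed over the obstacles, are negligible against Λ.
  rcases le_total Λ (10 * n) with hcase | hcase
  · intro w h1 h2
    refine le_trans ?_ (annulus_step_log h0 hs ht hd hμ hcase hA hF w h1 h2)
    rw [div_le_div_iff₀ (by positivity) (by positivity)]
    nlinarith
  intro z hz1 hz2
  rcases hz1.eq_or_lt with hz1 | hz1
  · refine le_trans ?_ (hF z hz1.symm)
    rw [div_le_iff₀ (by positivity)]
    nlinarith
  have hlog80 : Real.log 5 + Real.log 16 ≤ 5 := by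
    rw [← Real.log_mul (by norm_num) (by norm_num), Real.log_le_iff_le_exp (by norm_num)]
    have h1 := Real.exp_one_gt_d9
    have h2 : Real.exp 5 = Real.exp 1 ^ 5 := by rw [← Real.exp_nat_mul]; norm_num
    rw [h2]
    have := pow_le_pow_left₀ (by norm_num) h1.le 5
    norm_num at this ⊢
    linarith
  have hlog5 : 0 ≤ Real.log 5 := Real.log_nonneg (by norm_num)
  have hlog16 : 0 ≤ Real.log 16 := Real.log_nonneg (by norm_num)
  set B := A.filter fun a => d ≤ supN a with hB
  set m : ℝ := (B.card : ℝ) with hm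
  have hmn : m ≤ n := by
    rw [hm]; exact_mod_cast (Finset.card_filter_le _ _).trans hAn
  have hm0 : 0 ≤ m := by positivity
  -- A lower bound for the sum of `greenBound` at any obstacle: 2Λ from that obstacle itself and Λ -
  -- log 5 from each other one. At z the sum is at most m(Λ + log 16), so φ(z) retains roughly Λ/D,
  -- of order 1/n.
  set D : ℝ := (m + 1) * Λ - m * Real.log 5 with hD
  have hΛ10 : 10 * m ≤ Λ := by linarith
  have hΛ0 : 0 < Λ := by linarith
  have hDpos : Λ ≤ D := by rw [hD]; nlinarith
  set φ : ℤ × ℤ → ℝ := fun w => 1 - D⁻¹ * ∑ y ∈ B, greenBound t y w with hφ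
  have hD0 : 0 < D := by linarith
  have hcmp := comparison (Ω := {w | t < supN w ∧ w ∉ A})
    ⟨0, fun h => by have := h.1; simp [supN] at this; omega⟩
    (φ := fun w => μ * φ w) (F := F)
    (C := μ * (1 + D⁻¹ * ∑ y ∈ B, (Real.log (4 * (5 / 2 + 2 * sqN (0 - y))) -
      Real.log (4 * (supN y : ℝ) ^ 2) + Real.log ((t : ℝ) ^ 2 - 1))))
    (fun w hw => by
      apply mul_le_mul_of_nonneg_left _ hμ
      have : ∑ y ∈ B, -greenBound t y w ≤ ∑ y ∈ B, (Real.log (4 * (5 / 2 + 2 * sqN (0 - y))) -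
          Real.log (4 * (supN y : ℝ) ^ 2) + Real.log ((t : ℝ) ^ 2 - 1)) := by
        apply Finset.sum_le_sum
        intro y _
        have h1 := logUp_sub_logDown_le y 0 w (fun h => by
          have := hw.1; rw [h] at this; simp [supN] at this; omega)
        rw [sub_zero] at h1
        unfold greenBound
        linarith
      have h2 := mul_le_mul_of_nonneg_left this (inv_nonneg.mpr hD0.le)
      rw [Finset.sum_neg_distrib] at h2
      simp only [hφ]
      linarith)
    (fun w _ => h0 w)
    (fun w hw => by
      have h1 : nbrAvg (fun w => μ * φ w) w = μ * nbrAvg φ w := by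
        unfold nbrAvg; ring
      rw [h1]
      apply mul_le_mul_of_nonneg_left _ hμ
      have h2 : nbrAvg φ w = 1 - D⁻¹ * ∑ y ∈ B, nbrAvg (greenBound t y) w := by
        simp only [nbrAvg, ← Finset.sum_div, Finset.sum_add_distrib, hφ]
        ring
      rw [h2]
      have h3 : ∑ y ∈ B, nbrAvg (greenBound t y) w ≤ ∑ y ∈ B, greenBound t y w := by
        apply Finset.sum_le_sum
        intro y _
        have h4 : nbrAvg (greenBound t y) w = nbrAvg logDown w + Real.log (4 * (supN y : ℝ) ^ 2) -
            nbrAvg logUp (w - y) - Real.log ((t : ℝ) ^ 2 - 1) := by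
          rw [← nbrAvg_comp_sub]; simp only [nbrAvg, greenBound]; ring
        rw [h4]
        have h5 := logUp_subharmonic (w - y)
        have h6 := logDown_superharmonic (w := w) (fun h => by
          have := hw.1; rw [h] at this; simp [supN] at this; omega)
        unfold greenBound
        linarith
      have h5 := mul_le_mul_of_nonneg_left h3 (inv_nonneg.mpr hD0.le)
      simp only [hφ]
      linarith)
    (fun w hw => hs w hw.2)
    (fun w hw e he hne => by
      have h1 := supN_add_unit (w := w) he
      have hw1 := hw.1
      by_cases h2 : supN (w + e) ≤ t
      · have h3 : supN (w + e) = t := by omega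
        refine le_trans ?_ (hF _ h3)
        have h4 : 0 ≤ ∑ y ∈ B, greenBound t y (w + e) := Finset.sum_nonneg fun y hy =>
          greenBound_nonneg_of_ring ht h3 (hd.trans (Finset.mem_filter.mp hy).2)
        have h5 : φ (w + e) ≤ 1 := by
          simp only [hφ]
          have := mul_nonneg (inv_nonneg.mpr hD0.le) h4
          linarith
        calc μ * φ (w + e) ≤ μ * 1 := mul_le_mul_of_nonneg_left h5 hμ
          _ = μ := mul_one μ
      · have h3 : w + e ∈ A := by
          by_contra h
          exact hne ⟨by omega, h⟩
        have h4 : w + e ∈ B :=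
          Finset.mem_filter.mpr ⟨h3, (hA _ h3).resolve_left h2⟩
        refine le_trans ?_ (h0 _)
        apply mul_nonpos_of_nonneg_of_nonpos hμ
        have h5 : D ≤ ∑ y ∈ B, greenBound t y (w + e) := by
          rw [← Finset.add_sum_erase B _ h4]
          have h6 := le_greenBound_self ht hd (Finset.mem_filter.mp h4).2
          have h7 : ((B.erase (w + e)).card : ℝ) * (Λ - Real.log 5) ≤
              ∑ y ∈ B.erase (w + e), greenBound t y (w + e) := by
            rw [← nsmul_eq_mul]
            apply Finset.card_nsmul_le_sum
            intro y hy
            exact le_greenBound_of_ne ht hd (Finset.mem_filter.mp h4).2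
              (Finset.mem_filter.mp (Finset.mem_of_mem_erase hy)).2
          have h8 : ((B.erase (w + e)).card : ℝ) = m - 1 := by
            rw [Finset.card_erase_of_mem h4, Nat.cast_sub (Finset.card_pos.mpr ⟨_, h4⟩)]
            simp [hm]
          rw [h8] at h7
          rw [hD]
          linarith
        have h6 : 1 ≤ D⁻¹ * ∑ y ∈ B, greenBound t y (w + e) := by
          rw [inv_mul_eq_div, one_le_div hD0]; exact h5
        simp only [hφ]
        linarith)
    z ⟨hz1, fun h => by have := hA z h; have := supN_nonneg z; omega⟩
  refine le_trans ?_ hcmp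
  have h1 : ∑ y ∈ B, greenBound t y z ≤ m * (Λ + Real.log 16) := by
    rw [hm, ← nsmul_eq_mul]
    apply Finset.sum_le_card_nsmul
    intro y hy
    exact greenBound_le ht hd (Finset.mem_filter.mp hy).2 hz1.le hz2
  have h2 : 1 / (22 * n) ≤ φ z := by
    have h3 : D⁻¹ * ∑ y ∈ B, greenBound t y z ≤ 1 - 1 / (22 * n) := by
      rw [inv_mul_eq_div, div_le_iff₀ hD0]
      refine h1.trans ?_
      have h4 : 1 / (22 * (n : ℝ)) * D ≤ Λ / 2 := by
        rw [div_mul_eq_mul_div, div_le_div_iff₀ (by positivity) (by norm_num)]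
        have : D ≤ (n + 1) * Λ := by rw [hD]; nlinarith
        nlinarith
      have h5 : m * (Real.log 5 + Real.log 16) ≤ m * 5 := mul_le_mul_of_nonneg_left hlog80 hm0
      have h6 : (1 - 1 / (22 * (n : ℝ))) * D = D - 1 / (22 * (n : ℝ)) * D := by ring
      rw [h6]
      have h7 : D = m * Λ + Λ - m * Real.log 5 := by rw [hD]; ring
      linarith
    simp only [hφ]
    linarith
  calc μ / (22 * n) = μ * (1 / (22 * n)) := by ring
    _ ≤ μ * φ z := mul_le_mul_of_nonneg_left h2 hμ

/-! ### Lattice paths, and propagation of bounds along them. -/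

/-- Nearest-neighbour paths of a given length inside a set. -/
inductive LatticePath (S : Set (ℤ × ℤ)) : ℕ → ℤ × ℤ → ℤ × ℤ → Prop
  | refl (p : ℤ × ℤ) (hp : p ∈ S) : LatticePath S 0 p p
  | step {k : ℕ} {p q : ℤ × ℤ} (e : ℤ × ℤ) (h : LatticePath S k p q) (he : e ∈ unitSteps)
      (hq : q + e ∈ S) : LatticePath S (k + 1) p (q + e)

namespace LatticePath

variable {S T : Set (ℤ × ℤ)} {k l : ℕ} {p q r : ℤ × ℤ}

theorem mono (hST : S ⊆ T) (h : LatticePath S k p q) : LatticePath T k p q := by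
  induction h with
  | refl p hp => exact .refl p (hST hp)
  | step e _ he hq ih => exact .step e ih he (hST hq)

theorem trans (h₁ : LatticePath S k p q) (h₂ : LatticePath S l q r) :
    LatticePath S (k + l) p r := by
  induction h₂ with
  | refl p hp => exact h₁
  | step e _ he hq ih => exact .step e (ih h₁) he hq

theorem right_mem (h : LatticePath S k p q) : q ∈ S := by
  cases h with
  | refl p hp => exact hp
  | step e _ he hq => exact hq

theorem straight {e : ℤ × ℤ} (he : e ∈ unitSteps) (p : ℤ × ℤ) (k : ℕ)
    (h : ∀ i : ℕ, i ≤ k → p + (i : ℤ) • e ∈ S) : LatticePath S k p (p + (k : ℤ) • e) := by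
  induction k with
  | zero => simpa using LatticePath.refl p (by simpa using h 0 le_rfl)
  | succ k ih =>
    have h1 := ih fun i hi => h i (by omega)
    have h2 : p + ((k + 1 : ℕ) : ℤ) • e = p + (k : ℤ) • e + e := by
      push_cast; rw [add_smul, one_smul, add_assoc]
    rw [h2]
    exact .step e h1 he (h2 ▸ h (k + 1) le_rfl)

theorem vertical {a b c : ℤ} (h : ∀ y, min b c ≤ y → y ≤ max b c → (a, y) ∈ S) :
    LatticePath S (c - b).natAbs (a, b) (a, c) := by
  rcases le_total b c with hbc | hbc
  · have := straight (S := S) (e := (0, 1)) (by simp [unitSteps]) (a, b) (c - b).natAbs (fun i hi => by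
      have h2 : (a, b) + (i : ℤ) • ((0, 1) : ℤ × ℤ) = (a, b + i) := by ext <;> simp
      rw [h2]
      exact h _ (by omega) (by omega))
    have h2 : (a, b) + ((c - b).natAbs : ℤ) • ((0, 1) : ℤ × ℤ) = (a, c) := by
      ext <;> simp; rcases abs_cases (c - b) with h | h <;> omega
    rwa [h2] at this
  · have := straight (S := S) (e := (0, -1)) (by simp [unitSteps]) (a, b) (c - b).natAbs
      (fun i hi => by
      have h2 : (a, b) + (i : ℤ) • ((0, -1) : ℤ × ℤ) = (a, b - i) := by ext <;> simp; ring
      rw [h2]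
      exact h _ (by omega) (by omega))
    have h2 : (a, b) + ((c - b).natAbs : ℤ) • ((0, -1) : ℤ × ℤ) = (a, c) := by
      ext <;> simp; rcases abs_cases (c - b) with h | h <;> omega
    rwa [h2] at this

theorem horizontal {a b c : ℤ} (h : ∀ x, min a b ≤ x → x ≤ max a b → (x, c) ∈ S) :
    LatticePath S (b - a).natAbs (a, c) (b, c) := by
  rcases le_total a b with hab | hab
  · have := straight (S := S) (e := (1, 0)) (by simp [unitSteps]) (a, c) (b - a).natAbs (fun i hi => by
      have h2 : (a, c) + (i : ℤ) • ((1, 0) : ℤ × ℤ) = (a + i, c) := by ext <;> simp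
      rw [h2]
      exact h _ (by omega) (by omega))
    have h2 : (a, c) + ((b - a).natAbs : ℤ) • ((1, 0) : ℤ × ℤ) = (b, c) := by
      ext <;> simp; rcases abs_cases (b - a) with h | h <;> omega
    rwa [h2] at this
  · have := straight (S := S) (e := (-1, 0)) (by simp [unitSteps]) (a, c) (b - a).natAbs
      (fun i hi => by
      have h2 : (a, c) + (i : ℤ) • ((-1, 0) : ℤ × ℤ) = (a - i, c) := by ext <;> simp; ring
      rw [h2]
      exact h _ (by omega) (by omega))
    have h2 : (a, c) + ((b - a).natAbs : ℤ) • ((-1, 0) : ℤ × ℤ) = (b, c) := by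
      ext <;> simp; rcases abs_cases (b - a) with h | h <;> omega
    rwa [h2] at this

/-- Any two points of a square ring, one of them on the right side, are joined inside the ring. -/
theorem ring {t : ℕ} {h : ℤ} (hh : |h| ≤ t) {w : ℤ × ℤ} (hw : supN w = t)
    (hS : ∀ v, supN v = t → v ∈ S) : ∃ k ≤ 8 * t, LatticePath S k (t, h) w := by
  obtain ⟨x, y⟩ := w
  have hx : |x| ≤ t := (le_max_left _ _).trans hw.le
  have hy : |y| ≤ t := (le_max_right _ _).trans hw.le
  have hside : |x| = t ∨ |y| = t := by
    rcases max_choice |x| |y| with h' | h'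
    · left; rw [← hw]; exact h'.symm
    · right; rw [← hw]; exact h'.symm
  have hV : ∀ (s b : ℤ), |s| = t → |b| ≤ t → (s, b) ∈ S := fun s b hs hb =>
    hS _ (by simp only [supN]; rw [hs]; exact max_eq_left hb)
  have hH : ∀ (s b : ℤ), |s| = t → |b| ≤ t → (b, s) ∈ S := fun s b hs hb =>
    hS _ (by simp only [supN]; rw [hs]; exact max_eq_right hb)
  have hat : |(t : ℤ)| = t := abs_of_nonneg (by omega)
  have hat' : |(-t : ℤ)| = t := by rw [abs_neg, hat]
  rw [abs_le] at hx hy hh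
  have V : ∀ s b c : ℤ, |s| = t → -(t : ℤ) ≤ b → b ≤ t → -(t : ℤ) ≤ c → c ≤ t →
      LatticePath S (c - b).natAbs (s, b) (s, c) := fun s b c hs h1 h2 h3 h4 =>
    vertical fun y' h5 h6 => hV _ _ hs (abs_le.mpr ⟨by omega, by omega⟩)
  have H : ∀ s b c : ℤ, |s| = t → -(t : ℤ) ≤ b → b ≤ t → -(t : ℤ) ≤ c → c ≤ t →
      LatticePath S (c - b).natAbs (b, s) (c, s) := fun s b c hs h1 h2 h3 h4 =>
    horizontal fun y' h5 h6 => hH _ _ hs (abs_le.mpr ⟨by omega, by omega⟩)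
  rcases hside with hs | hs
  · rcases abs_eq (by omega : (0 : ℤ) ≤ t) |>.mp hs with rfl | rfl
    · exact ⟨_, by omega, V t h y hat hh.1 hh.2 hy.1 hy.2⟩
    · exact ⟨_, by omega, ((V t h t hat hh.1 hh.2 (by omega) (by omega)).trans
        (H t t (-t) hat (by omega) (by omega) (by omega) (by omega))).trans
        (V (-t) t y hat' (by omega) (by omega) hy.1 hy.2)⟩
  · rcases abs_eq (by omega : (0 : ℤ) ≤ t) |>.mp hs with rfl | rfl
    · exact ⟨_, by omega, (V t h t hat hh.1 hh.2 (by omega) (by omega)).trans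
        (H t t x hat (by omega) (by omega) hx.1 hx.2)⟩
    · exact ⟨_, by omega, (V t h (-t) hat hh.1 hh.2 (by omega) (by omega)).trans
        (H (-t) t x hat' (by omega) (by omega) hx.1 hx.2)⟩

end LatticePath

/-- A lower bound on a box propagates along a lattice path that stays away from the obstacles. -/
theorem chain_step {A : Finset (ℤ × ℤ)} {F : ℤ × ℤ → ℝ} (h0 : ∀ w, 0 ≤ F w)
    (hs : ∀ w, w ∉ A → nbrAvg F w ≤ F w) {p q : ℤ × ℤ} {σ k : ℕ} {μ : ℝ} (hσ : 2 ≤ σ) (hμ : 0 ≤ μ)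
    (hF : ∀ w, supN (w - p) ≤ σ → μ ≤ F w)
    (h : LatticePath {v | ∀ a ∈ A, 4 * (σ : ℤ) ≤ supN (a - v)} k p q) :
    ∀ w, supN (w - q) ≤ 2 * σ - (k % σ : ℕ) → μ / 6 ^ (k / σ + 1) ≤ F w := by
  induction h with
  | refl p hp =>
    intro w hw
    have := ball_step h0 hs (by omega) hμ hp hF w (by simpa using hw)
    simpa using this
  | @step k p q e h he hq ih =>
    intro w hw
    have hq1 : supN (q + e - q) = 1 := by rw [add_sub_cancel_left]; exact supN_unitSteps he
    -- The guaranteed box loses one unit of radius per step. After σ steps its radius is down from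
    -- 2σ to σ, and `ball_step` doubles it again for a factor 6.
    have hmod : k % σ < σ := Nat.mod_lt _ (by omega)
    by_cases hlast : k % σ + 1 = σ
    · have hdiv : (k + 1) / σ = k / σ + 1 := by
        have := Nat.div_add_mod k σ
        apply Nat.div_eq_of_lt_le
        · nlinarith
        · nlinarith
      have hbox : ∀ v, supN (v - (q + e)) ≤ σ → μ / 6 ^ (k / σ + 1) ≤ F v := by
        intro v hv
        apply ih hF v
        have := supN_sub_le v (q + e) q
        omega
      have := ball_step h0 hs (by omega) (by positivity) hq hbox w (by omega)
      rw [hdiv, pow_succ, ← div_div]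
      exact this
    · have hdm := Nat.div_add_mod k σ
      have hdiv : (k + 1) / σ = k / σ := by
        apply Nat.div_eq_of_lt_le
        · nlinarith [Nat.zero_le (k % σ)]
        · nlinarith [(by omega : k % σ + 1 < σ)]
      have hmod' : (k + 1) % σ = k % σ + 1 := by
        have := Nat.div_add_mod (k + 1) σ
        rw [hdiv] at this
        omega
      rw [hdiv]
      apply ih hF w
      have := supN_sub_le w (q + e) q
      rw [hmod'] at hw
      push_cast at hw ⊢
      omega

/-- Pigeonhole: a point of T is within ρ of at most one of m + 1 centres spaced 2ρ apart. It selects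
both free radii and free corridors. -/
theorem exists_spaced_away (T : Finset ℤ) (m : ℕ) (hT : T.card ≤ m) (b ρ : ℤ) (hρ : 1 ≤ ρ) :
    ∃ i : ℕ, i ≤ m ∧ ∀ v ∈ T, ρ ≤ |v - (b + 2 * ρ * i)| := by
  by_contra hcon
  push Not at hcon
  have hch : ∀ i : ℕ, ∃ v, i ≤ m → v ∈ T ∧ |v - (b + 2 * ρ * i)| < ρ := by
    intro i
    by_cases hi : i ≤ m
    · obtain ⟨v, hv⟩ := hcon i hi
      exact ⟨v, fun _ => hv⟩
    · exact ⟨0, fun h => absurd h hi⟩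
  choose f hf using hch
  obtain ⟨i, hi, j, hj, hij, hfij⟩ := Finset.exists_ne_map_eq_of_card_lt_of_maps_to
    (s := Finset.range (m + 1)) (t := T) (by simpa using by omega) (f := f)
    (fun i hi => (hf i (by simpa [Nat.lt_succ_iff] using hi)).1)
  have h1 := (hf i (by simpa [Nat.lt_succ_iff] using hi)).2
  have h2 := (hf j (by simpa [Nat.lt_succ_iff] using hj)).2
  rw [hfij] at h1
  rw [abs_lt] at h1 h2
  rcases lt_or_gt_of_ne hij with h | h
  · have h3 : (i : ℤ) + 1 ≤ j := by exact_mod_cast h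
    nlinarith
  · have h3 : (j : ℤ) + 1 ≤ i := by exact_mod_cast h
    nlinarith

theorem abs_supN_sub_le (v w : ℤ × ℤ) : |supN v - supN w| ≤ supN (v - w) := by
  rw [abs_le]
  have h1 := le_supN_sub v w
  have h2 := le_supN_sub w v
  rw [supN_sub_comm] at h2
  constructor <;> linarith

/-- Passing from a thick free ring to a thick free ring at a larger scale, at a cost exponential in
the number of obstacles in between. -/
theorem ring_step {A : Finset (ℤ × ℤ)} {F : ℤ × ℤ → ℝ} (h0 : ∀ w, 0 ≤ F w)
    (hs : ∀ w, w ∉ A → nbrAvg F w ≤ F w) {t ρ s m : ℕ} {μ : ℝ} (hρ : 2 ≤ ρ) (hμ : 0 ≤ μ)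
    (hts : t ≤ s * ρ) (hmt : 32 * (m + 1) ≤ t)
    (hclear : ∀ a ∈ A, 8 * (ρ : ℤ) ≤ |supN a - t|)
    (hm : (A.filter fun a => (t : ℤ) < supN a ∧ supN a ≤ 256 * t).card ≤ m)
    (hF : ∀ w, |supN w - t| ≤ ρ → μ ≤ F w) :
    ∃ t' ρ' : ℕ, 128 * t ≤ t' ∧ t' ≤ 256 * t ∧ 2 ≤ ρ' ∧ t' ≤ (8192 * (m + 1)) * ρ' ∧
      (∀ a ∈ A, 8 * (ρ' : ℤ) ≤ |supN a - t'|) ∧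
      ∀ w, |supN w - t'| ≤ ρ' → μ / 6 ^ (1170 * (s + 32 * (m + 1)) + 1) ≤ F w := by
  -- With this thickness, m + 1 disjoint layers of half-width 8ρ' fit between radii 128t and 129t.
  obtain ⟨ρ', hρ'⟩ : ∃ ρ', ρ' = t / (16 * (m + 1)) := ⟨_, rfl⟩
  have hρ'1 : ρ' * (16 * (m + 1)) ≤ t := hρ' ▸ Nat.div_mul_le_self _ _
  have hρ'2 : t < (ρ' + 1) * (16 * (m + 1)) := by
    rw [hρ', mul_comm]; exact Nat.lt_mul_div_succ _ (by omega)
  have hρ'3 : 2 ≤ ρ' := by rw [hρ', Nat.le_div_iff_mul_le (by omega)]; omega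
  have hρ't : t ≤ 32 * (m + 1) * ρ' := by nlinarith
  set N := A.filter fun a => (t : ℤ) < supN a ∧ supN a ≤ 256 * t with hN
  obtain ⟨i, him, hi⟩ := exists_spaced_away (N.image supN) m (Finset.card_image_le.trans hm)
    (128 * t + 8 * ρ') (8 * ρ') (by omega)
  obtain ⟨σ, hσ⟩ : ∃ σ, σ = min ρ ρ' := ⟨_, rfl⟩
  obtain ⟨j, hjm, hj⟩ := exists_spaced_away (N.image Prod.snd) m (Finset.card_image_le.trans hm)
    0 (4 * σ) (by omega)
  have hσρ : σ ≤ ρ := hσ ▸ min_le_left _ _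
  have hσρ' : σ ≤ ρ' := hσ ▸ min_le_right _ _
  have hσ2 : 2 ≤ σ := hσ ▸ le_min hρ hρ'3
  obtain ⟨t', ht'⟩ : ∃ t' : ℕ, t' = 128 * t + 8 * ρ' + 16 * ρ' * i := ⟨_, rfl⟩
  have ht'u : t' + 8 * ρ' ≤ 129 * t := by
    have : ρ' * i ≤ ρ' * m := Nat.mul_le_mul_left _ him
    nlinarith
  have h8ρ' : 16 * ρ' ≤ t := by nlinarith
  obtain ⟨h, hh⟩ : ∃ h : ℕ, h = 8 * σ * j := ⟨_, rfl⟩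
  have hht : h ≤ t := by
    have h1 : σ * j ≤ ρ' * m := Nat.mul_le_mul hσρ' hjm
    nlinarith
  have hclear' : ∀ a ∈ A, 8 * (ρ' : ℤ) ≤ |supN a - t'| := by
    intro a ha
    by_cases haN : a ∈ N
    · have := hi _ (Finset.mem_image_of_mem supN haN)
      have h2 : (128 * t + 8 * ρ' + 2 * (8 * ρ') * i : ℤ) = t' := by rw [ht']; push_cast; ring
      rwa [h2] at this
    · have : ¬ ((t : ℤ) < supN a ∧ supN a ≤ 256 * t) := fun h => haN (Finset.mem_filter.mpr ⟨ha, h⟩)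
      rw [le_abs]
      omega
  refine ⟨t', ρ', by omega, by omega, hρ'3, ?_, hclear', ?_⟩
  · nlinarith
  intro w hw
  obtain ⟨t₂, ht₂⟩ : ∃ t₂ : ℕ, supN w = t₂ := ⟨(supN w).toNat, by have := supN_nonneg w; omega⟩
  rw [ht₂, abs_le] at hw
  set S : Set (ℤ × ℤ) := {v | ∀ a ∈ A, 4 * (σ : ℤ) ≤ supN (a - v)} with hS
  -- The corridor at height h avoids the obstacles of N by its height, and all others by their
  -- distance to the origin. The path then continues around the ring of radius t₂.
  have hcorr : LatticePath S ((t₂ : ℤ) - t).natAbs ((t : ℤ), (h : ℤ)) ((t₂ : ℤ), (h : ℤ)) := by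
    apply LatticePath.horizontal
    intro x hx1 hx2 a ha
    have hx1' : (t : ℤ) ≤ x := by omega
    have hx2' : x ≤ t₂ := by omega
    have hq : supN (x, (h : ℤ)) = x := by
      simp only [supN]; rw [abs_of_nonneg (by omega), abs_of_nonneg (by omega)]; omega
    have hdist := abs_supN_sub_le a (x, (h : ℤ))
    rw [hq] at hdist
    by_cases haN : a ∈ N
    · have h1 := hj _ (Finset.mem_image_of_mem Prod.snd haN)
      have h2 : (0 + 2 * (4 * σ) * j : ℤ) = h := by rw [hh]; push_cast; ring
      rw [h2] at h1
      exact h1.trans (le_max_right _ _)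
    · have h1 : ¬ ((t : ℤ) < supN a ∧ supN a ≤ 256 * t) :=
        fun h => haN (Finset.mem_filter.mpr ⟨ha, h⟩)
      refine le_trans ?_ hdist
      have h2 := hclear a ha
      rw [le_abs] at h2 ⊢
      omega
  have hring : ∃ k ≤ 8 * t₂, LatticePath S k ((t₂ : ℤ), (h : ℤ)) w := by
    apply LatticePath.ring _ ht₂
    · intro v hv a ha
      refine le_trans ?_ (abs_supN_sub_le a v)
      have h2 := hclear' a ha
      rw [hv]
      rw [le_abs] at h2 ⊢
      omega
    · rw [abs_of_nonneg (by omega)]; omega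
  obtain ⟨k, hk, hpath⟩ := hring
  have hend := chain_step h0 hs hσ2 hμ (fun v hv => hF v (by
    have h1 := abs_supN_sub_le v ((t : ℤ), (h : ℤ))
    have h2 : supN ((t : ℤ), (h : ℤ)) = t := by
      simp only [supN]; rw [abs_of_nonneg (by omega), abs_of_nonneg (by omega)]; omega
    rw [h2] at h1
    omega)) (hcorr.trans hpath) w (by
      have := Nat.mod_lt (((t₂ : ℤ) - t).natAbs + k) (by omega : 0 < σ)
      rw [sub_self]
      have h0 : supN 0 = 0 := by simp [supN]
      rw [h0]; omega)
  refine le_trans ?_ hend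
  apply div_le_div_of_nonneg_left hμ (by positivity)
  apply pow_le_pow_right₀ (by norm_num)
  -- Since t₂ ≤ 129t, the corridor and the ring have total length at most 9 · 129t = 1161t.
  have hlen : ((t₂ : ℤ) - t).natAbs + k ≤ 1170 * t := by omega
  have htσ : t ≤ (s + 32 * (m + 1)) * σ := by
    rcases min_choice ρ ρ' with h1 | h1
    · rw [hσ, h1]; nlinarith
    · rw [hσ, h1]; nlinarith
  have : (((t₂ : ℤ) - t).natAbs + k) / σ ≤ 1170 * (s + 32 * (m + 1)) := by
    apply Nat.div_le_of_le_mul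
    nlinarith
  omega

/-- A lower bound on a ring that encloses all obstacles holds everywhere outside. -/
theorem outside_step {A : Finset (ℤ × ℤ)} {F : ℤ × ℤ → ℝ} (h0 : ∀ w, 0 ≤ F w)
    (hs : ∀ w, w ∉ A → nbrAvg F w ≤ F w) {t : ℤ} (ht : 0 ≤ t) {μ : ℝ}
    (hA : ∀ a ∈ A, supN a ≤ t) (hF : ∀ w, supN w = t → μ ≤ F w) :
    ∀ w, t ≤ supN w → μ ≤ F w := by
  intro w hw
  rcases hw.eq_or_lt with hw | hw
  · exact hF w hw.symm
  exact comparison (Ω := {w | t < supN w}) ⟨0, by simp [supN, ht]⟩ (φ := fun _ => μ) (F := F)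
    (C := μ) (fun _ _ => le_rfl) (fun w _ => h0 w)
    (fun w _ => by simp only [nbrAvg]; linarith)
    (fun w hw => hs w fun h => absurd (hA w h) (not_le.mpr hw))
    (fun w hw e he hne => hF _ (by
      have := (supN_add_unit (w := w) he).2
      simp only [Set.mem_ofPred_eq, not_lt] at hw hne
      omega)) w hw

/-! ### The multiscale induction. -/

/-- The number of obstacles outside radius `t`, those outside radius `128 t` counted twice. -/
def outerCount (A : Finset (ℤ × ℤ)) (t : ℕ) : ℕ :=
  (A.filter fun a => (t : ℤ) < supN a).card + (A.filter fun a => 128 * (t : ℤ) < supN a).card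

theorem outerCount_anti (A : Finset (ℤ × ℤ)) {t t' : ℕ} (h : t ≤ t') :
    outerCount A t' ≤ outerCount A t := by
  unfold outerCount
  apply add_le_add <;> apply Finset.card_le_card <;> apply Finset.monotone_filter_right <;>
    intro a ha <;> omega

theorem outerCount_le (A : Finset (ℤ × ℤ)) (t : ℕ) : outerCount A t ≤ 2 * A.card := by
  unfold outerCount
  have h1 := Finset.card_filter_le A fun a => (t : ℤ) < supN a
  have h2 := Finset.card_filter_le A fun a => 128 * (t : ℤ) < supN a
  omega

/-- The double counting makes every obstacle in (t, 256t] contribute a drop: those up to 128t go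
from one to zero, and those beyond go from two to at most one, because 128t' exceeds 256t. Thus the
new ring may lie inside some of the obstacles charged to this round. -/
theorem outerCount_add_le (A : Finset (ℤ × ℤ)) {t t' : ℕ} (h1 : 128 * t ≤ t') :
    outerCount A t' + (A.filter fun a => (t : ℤ) < supN a ∧ supN a ≤ 256 * t).card ≤
      outerCount A t := by
  simp only [outerCount, Finset.card_filter, ← Finset.sum_add_distrib]
  apply Finset.sum_le_sum
  intro a _
  split_ifs <;> omega

/-- The multiscale lower bound: from a thick free ring outwards, each obstacle costs a factor of
order `1 / n`. -/
theorem multiscale_lower_bound {A : Finset (ℤ × ℤ)} {F : ℤ × ℤ → ℝ} (h0 : ∀ w, 0 ≤ F w)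
    (hs : ∀ w, w ∉ A → nbrAvg F w ≤ F w) {n : ℕ} (hn : 1 ≤ n) (hAn : A.card ≤ n) {B : ℕ}
    (hB : 19319041 ≤ B) (Ψ : ℕ) :
    ∀ (t ρ s : ℕ) (μ : ℝ), 32 * (n + 1) ≤ t → 2 ≤ ρ → t ≤ s * ρ → 0 ≤ μ →
      (∀ a ∈ A, 8 * (ρ : ℤ) ≤ |supN a - t|) → (∀ w, |supN w - t| ≤ ρ → μ ≤ F w) →
      outerCount A t ≤ Ψ →
      ∃ R : ℤ, ∀ w, R ≤ supN w → μ * (1 / 6) ^ (1170 * s) * ((1 / 6) ^ B / (22 * n)) ^ Ψ ≤ F w := by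
  have hn' : (1 : ℝ) ≤ n := by exact_mod_cast hn
  set Γ : ℝ := (1 / 6) ^ B / (22 * n) with hΓ
  have hΓ0 : 0 < Γ := by positivity
  have hΓ1 : Γ ≤ 1 := by
    rw [hΓ, div_le_one (by positivity)]
    have : (1 / 6 : ℝ) ^ B ≤ 1 := pow_le_one₀ (by norm_num) (by norm_num)
    linarith
  induction Ψ using Nat.strong_induction_on with
  | _ Ψ ih =>
  intro t ρ s μ ht hρ hts hμ hclear hF hΨ
  by_cases hout : ∀ a ∈ A, supN a ≤ t
  · refine ⟨t, fun w hw => ?_⟩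
    refine le_trans ?_ (outside_step h0 hs (by omega) hout
      (fun w hw => hF w (by rw [hw]; simp)) w hw)
    have h1 : (1 / 6 : ℝ) ^ (1170 * s) ≤ 1 := pow_le_one₀ (by norm_num) (by norm_num)
    have h2 : Γ ^ Ψ ≤ 1 := pow_le_one₀ hΓ0.le hΓ1
    rw [mul_assoc]
    exact mul_le_of_le_one_right hμ (mul_le_one₀ h1 (by positivity) h2)
  -- Normalisation to a ring with an obstacle within a factor 64 outside it. If there is none, the
  -- empty annulus is crossed to radius d/4, where d is the radius of the next obstacle.
  have hstate : ∃ (t₁ ρ₁ s₁ : ℕ), t ≤ t₁ ∧ 2 ≤ ρ₁ ∧ t₁ ≤ s₁ * ρ₁ ∧ s₁ ≤ s + 64 ∧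
      (∀ a ∈ A, 8 * (ρ₁ : ℤ) ≤ |supN a - t₁|) ∧
      (∀ w, |supN w - t₁| ≤ ρ₁ → μ / (22 * n) ≤ F w) ∧
      ∃ a ∈ A, (t₁ : ℤ) < supN a ∧ supN a < 64 * t₁ := by
    by_cases hnear : ∃ a ∈ A, (t : ℤ) < supN a ∧ supN a < 64 * t
    · refine ⟨t, ρ, s, le_rfl, hρ, hts, by omega, hclear, fun w hw => ?_, hnear⟩
      refine le_trans ?_ (hF w hw)
      rw [div_le_iff₀ (by positivity)]
      nlinarith
    · push Not at hout hnear
      obtain ⟨a₀, ha₀, ha₀t⟩ := hout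
      obtain ⟨a₁, ha₁, hmin⟩ := (A.filter fun a => (t : ℤ) < supN a).exists_min_image supN
        ⟨a₀, Finset.mem_filter.mpr ⟨ha₀, ha₀t⟩⟩
      rw [Finset.mem_filter] at ha₁
      have hd := hnear a₁ ha₁.1 ha₁.2
      obtain ⟨d, hd'⟩ : ∃ d : ℕ, supN a₁ = d := ⟨(supN a₁).toNat, by have := supN_nonneg a₁; omega⟩
      have hsep : ∀ a ∈ A, supN a ≤ t ∨ (d : ℤ) ≤ supN a := by
        intro a ha
        by_cases h : (t : ℤ) < supN a
        · right; rw [← hd']; exact hmin a (Finset.mem_filter.mpr ⟨ha, h⟩)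
        · left; omega
      have hann := annulus_step h0 hs hn hAn (t := t) (d := d) (by omega) (by omega) hμ hsep
        (fun w hw => hF w (by rw [hw]; simp))
      refine ⟨d / 4, d / 64, 64, by omega, by omega, by omega, by omega, ?_, ?_, a₁, ha₁.1, ?_, ?_⟩
      · intro a ha
        have := hsep a ha
        rw [le_abs]
        omega
      · intro w hw
        rw [abs_le] at hw
        exact hann w (by omega) (by omega)
      · omega
      · omega
  obtain ⟨t₁, ρ₁, s₁, htt₁, hρ₁, hts₁, hs₁, hclear₁, hF₁, a, ha, hat, ha64⟩ := hstate
  set m : ℕ := (A.filter fun a => (t₁ : ℤ) < supN a ∧ supN a ≤ 256 * t₁).card with hm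
  have hm1 : 1 ≤ m := Finset.card_pos.mpr ⟨a, Finset.mem_filter.mpr ⟨ha, hat, by omega⟩⟩
  have hmn : m ≤ n := (Finset.card_filter_le _ _).trans hAn
  have hμ₁ : 0 ≤ μ / (22 * n) := by positivity
  obtain ⟨t₂, ρ₂, h1, h2, h3, h4, h5, h6⟩ := ring_step h0 hs hρ₁ hμ₁ hts₁ (m := m) (by omega)
    hclear₁ le_rfl hF₁
  have hcount := outerCount_add_le A h1
  have hanti := outerCount_anti A htt₁
  obtain ⟨R, hR⟩ := ih (Ψ - m) (by omega) t₂ ρ₂ (8192 * (m + 1)) _ (by omega) h3 h4 (by positivity)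
    h5 h6 (by omega)
  refine ⟨R, fun w hw => le_trans ?_ (hR w hw)⟩
  have hΓm : Γ ^ Ψ = Γ ^ m * Γ ^ (Ψ - m) := by rw [← pow_add]; congr 1; omega
  rw [hΓm, ← mul_assoc]
  apply mul_le_mul_of_nonneg_right _ (by positivity)
  have hΓm' : Γ ^ m ≤ (1 / 6) ^ (B * m) / (22 * n) := by
    rw [hΓ, div_pow, ← pow_mul]
    apply div_le_div_of_nonneg_left (by positivity) (by positivity)
    calc (22 * n : ℝ) = (22 * n) ^ 1 := (pow_one _).symm
      _ ≤ (22 * n) ^ m := pow_le_pow_right₀ (by linarith) hm1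
  -- The worst case is m = 1 with s₁ = s + 64, and 1170 · (64 + 64 + 16384) + 1 = 19319041 is the
  -- threshold imposed on B.
  have hexp : 1170 * (s₁ + 32 * (m + 1)) + 1 + 1170 * (8192 * (m + 1)) ≤ 1170 * s + B * m := by
    have := Nat.mul_le_mul_right m hB
    linarith
  obtain ⟨E₁, hE₁⟩ : ∃ E, E = 1170 * (s₁ + 32 * (m + 1)) + 1 := ⟨_, rfl⟩
  rw [← hE₁] at hexp ⊢
  obtain ⟨E₂, hE₂⟩ : ∃ E, E = 1170 * (8192 * (m + 1)) := ⟨_, rfl⟩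
  rw [← hE₂] at hexp ⊢
  obtain ⟨E₃, hE₃⟩ : ∃ E, E = 1170 * s := ⟨_, rfl⟩
  rw [← hE₃] at hexp ⊢
  calc μ * (1 / 6) ^ E₃ * Γ ^ m ≤ μ * (1 / 6) ^ E₃ * ((1 / 6) ^ (B * m) / (22 * n)) := by gcongr
    _ = μ / (22 * n) * (1 / 6) ^ (E₃ + B * m) := by rw [pow_add]; ring
    _ ≤ μ / (22 * n) * (1 / 6) ^ (E₁ + E₂) := by
        apply mul_le_mul_of_nonneg_left _ hμ₁
        exact pow_le_pow_of_le_one (by norm_num) (by norm_num) hexp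
    _ = μ / (22 * n) / 6 ^ E₁ * (1 / 6) ^ E₂ := by
        rw [pow_add, ← mul_assoc, one_div_pow (6 : ℝ) E₁]; ring

/-! ### Discrete potentials and connectivity along the boundary of A. -/

theorem exists_antidifference {G : Type*} [AddCommGroup G] (f : ℤ → G) :
    ∃ s : ℤ → G, s 0 = 0 ∧ ∀ i, s (i + 1) = s i + f i := by
  refine ⟨fun i => match i with
    | Int.ofNat n => ∑ k ∈ Finset.range n, f k
    | Int.negSucc n => -∑ k ∈ Finset.range (n + 1), f (-(k + 1 : ℤ)), by simp, fun i => ?_⟩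
  match i with
  | Int.ofNat n => exact Finset.sum_range_succ (fun k : ℕ => f k) n
  | Int.negSucc 0 => simp
  | Int.negSucc (n + 1) =>
    change -∑ k ∈ Finset.range (n + 1), f (-(k + 1 : ℤ)) =
      -∑ k ∈ Finset.range (n + 1 + 1), f (-(k + 1 : ℤ)) + f (Int.negSucc (n + 1))
    rw [Finset.sum_range_succ _ (n + 1)]
    have : (Int.negSucc (n + 1)) = -(((n + 1 : ℕ) : ℤ) + 1) := by rw [Int.negSucc_eq]
    rw [this]
    abel

/-- A closed discrete one-form on the square lattice is exact. -/
theorem exists_potential {G : Type*} [AddCommGroup G] (hor ver : ℤ → ℤ → G)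
    (hcl : ∀ i j, hor i j + ver (i + 1) j = ver i j + hor i (j + 1)) :
    ∃ g : ℤ → ℤ → G, (∀ i j, g (i + 1) j = g i j + hor i j) ∧
      ∀ i j, g i (j + 1) = g i j + ver i j := by
  obtain ⟨s, -, hs⟩ := exists_antidifference fun i => hor i 0
  choose r hr0 hr using fun i => exists_antidifference (ver i)
  refine ⟨fun i j => s i + r i j, fun i j => ?_, fun i j => by beta_reduce; rw [hr, add_assoc]⟩
  have key : hor i 0 + r (i + 1) j = r i j + hor i j := by
    induction j using Int.induction_on with
    | zero => rw [hr0, hr0, add_zero, zero_add]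
    | succ k ih =>
      rw [hr, hr, ← add_assoc, ih, add_assoc, hcl, add_assoc]
    | pred k ih =>
      have h1 := hr (i + 1) (-(k : ℤ) - 1)
      have h2 := hr i (-(k : ℤ) - 1)
      have h3 := hcl i (-(k : ℤ) - 1)
      rw [sub_add_cancel] at h1 h2 h3
      rw [h1, h2] at ih
      have h4 : hor i 0 + r (i + 1) (-(k : ℤ) - 1) =
          (hor i 0 + (r (i + 1) (-(k : ℤ) - 1) + ver (i + 1) (-(k : ℤ) - 1))) -
            ver (i + 1) (-(k : ℤ) - 1) := by abel
      rw [h4, ih, add_assoc, ← h3]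
      abel
  beta_reduce
  rw [hs, add_assoc, key]
  abel

theorem neg_mem_unitSteps {e : ℤ × ℤ} (he : e ∈ unitSteps) : -e ∈ unitSteps := by
  simp only [unitSteps, Finset.mem_insert, Finset.mem_singleton] at he ⊢
  rcases he with rfl | rfl | rfl | rfl <;> decide

theorem squareLattice_adj_iff {p q : ℤ × ℤ} :
    squareLattice.Adj p q ↔ ∃ e ∈ unitSteps, q = p + e := by
  obtain ⟨a, b⟩ := p
  obtain ⟨c, d⟩ := q
  simp only [squareLattice, unitSteps, Finset.mem_insert, Finset.mem_singleton,
    exists_eq_or_imp, exists_eq_left, Prod.mk_add_mk, Prod.mk.injEq]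
  constructor
  · intro h
    rcases abs_cases (a - c) with h1 | h1 <;> rcases abs_cases (b - d) with h2 | h2 <;> omega
  · intro h
    rcases abs_cases (a - c) with h1 | h1 <;> rcases abs_cases (b - d) with h2 | h2 <;> omega

namespace LatticePath

variable {S : Set (ℤ × ℤ)} {k : ℕ} {p q : ℤ × ℤ}

theorem left_mem (h : LatticePath S k p q) : p ∈ S := by
  induction h with
  | refl p hp => exact hp
  | step e _ he hq ih => exact ih

theorem single {e : ℤ × ℤ} (hp : p ∈ S) (he : e ∈ unitSteps) (hq : p + e ∈ S) :
    LatticePath S 1 p (p + e) := .step e (.refl p hp) he hq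

theorem symm (h : LatticePath S k p q) : LatticePath S k q p := by
  induction h with
  | refl p hp => exact .refl p hp
  | @step k p q e h he hq ih =>
    have h1 : LatticePath S 1 (q + e) q := by
      have := single (S := S) hq (neg_mem_unitSteps he) (by simpa using h.right_mem)
      simpa using this
    have := h1.trans ih
    rwa [add_comm] at this

/-- Loop erasure: a simple path in the induced graph visits each vertex at most once. -/
theorem exists_lt_card (V : Finset (ℤ × ℤ)) (h : LatticePath (V : Set (ℤ × ℤ)) k p q) :
    ∃ l < V.card, LatticePath (V : Set (ℤ × ℤ)) l p q := by
  set G := squareLattice.induce (V : Set (ℤ × ℤ))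
  have hreach : ∀ {k p q} (h : LatticePath (V : Set (ℤ × ℤ)) k p q),
      G.Reachable ⟨p, h.left_mem⟩ ⟨q, h.right_mem⟩ := by
    intro k p q h
    induction h with
    | refl p hp => exact SimpleGraph.Reachable.refl _
    | step e h he hq ih =>
      refine ih.trans (SimpleGraph.Adj.reachable ?_)
      rw [SimpleGraph.comap_adj]
      exact squareLattice_adj_iff.mpr ⟨e, he, rfl⟩
  have hwalk : ∀ {u v : (V : Set (ℤ × ℤ))} (w : G.Walk u v),
      LatticePath (V : Set (ℤ × ℤ)) w.length u v := by
    intro u v w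
    induction w with
    | nil => exact .refl _ (Subtype.property _)
    | @cons u v w hadj w' ih =>
      rw [SimpleGraph.comap_adj] at hadj
      obtain ⟨e, he, hev⟩ := squareLattice_adj_iff.mp hadj
      have h1 : LatticePath (V : Set (ℤ × ℤ)) 1 u v := by
        have hv : (v : ℤ × ℤ) = u + e := hev
        rw [hv]
        exact single u.2 he (hv ▸ v.2)
      have := h1.trans ih
      rwa [SimpleGraph.Walk.length_cons, add_comm]
  obtain ⟨w, hw⟩ := (hreach h).exists_isPath
  refine ⟨w.length, ?_, hwalk w⟩
  have := hw.length_lt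
  simpa using this

end LatticePath

/-- If the origin is connected to a point of a horizontal ray in the complement of `A`, it is so
through points that lie on the ray or next to `A`. -/
theorem connected_along_boundary (A : Finset (ℤ × ℤ)) (N : ℕ) {k : ℕ}
    (hpath : LatticePath (A : Set (ℤ × ℤ))ᶜ k (0, 0) ((N : ℤ), 0)) :
    ∃ l, LatticePath {v | v ∉ A ∧ ((∃ i : ℕ, i ≤ N ∧ v = ((i : ℤ), 0)) ∨
      ∃ a ∈ A, supN (v - a) ≤ 1)} l (0, 0) ((N : ℤ), 0) := by
  classical
  set V : Set (ℤ × ℤ) := {v | v ∉ A ∧ ((∃ i : ℕ, i ≤ N ∧ v = ((i : ℤ), 0)) ∨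
      ∃ a ∈ A, supN (v - a) ≤ 1)} with hV
  set χ : ℤ × ℤ → ZMod 2 := fun v => if ∃ l, LatticePath V l (0, 0) v then 1 else 0 with hχ
  have hdouble : ∀ x : ZMod 2, x + x = 0 := by decide
  have hχstep : ∀ p ∈ V, ∀ e ∈ unitSteps, p + e ∈ V → χ p = χ (p + e) := by
    intro p hp e he hq
    have : (∃ l, LatticePath V l (0, 0) p) ↔ ∃ l, LatticePath V l (0, 0) (p + e) :=
      ⟨fun ⟨l, hl⟩ => ⟨_, hl.trans (.single hp he hq)⟩,
        fun ⟨l, hl⟩ => ⟨_, hl.trans (LatticePath.single hp he hq).symm⟩⟩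
    simp only [hχ, this]
  -- The mod 2 coboundary of the reachability indicator χ, cut off on edges touching A. It stays
  -- closed: the free corners of a unit square meeting A all lie in V, so ω vanishes on its four
  -- edges.
  set ω : ℤ × ℤ → ℤ × ℤ → ZMod 2 := fun p q => if p ∈ A ∨ q ∈ A then 0 else χ p + χ q with hω
  have hω0 : ∀ p e, e ∈ unitSteps → (p ∉ A → p ∈ V) → (p + e ∉ A → p + e ∈ V) →
      ω p (p + e) = 0 := by
    intro p e he h1 h2
    simp only [hω]
    split_ifs with h
    · rfl
    · push Not at h
      rw [hχstep p (h1 h.1) e he (h2 h.2), hdouble]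
  have hr : ((1, 0) : ℤ × ℤ) ∈ unitSteps := by decide
  have hu : ((0, 1) : ℤ × ℤ) ∈ unitSteps := by decide
  obtain ⟨g, hg1, hg2⟩ := exists_potential (fun i j => ω (i, j) ((i, j) + (1, 0)))
    (fun i j => ω (i, j) ((i, j) + (0, 1))) (by
      intro i j
      by_cases hcorner : (i, j) ∈ A ∨ (i + 1, j) ∈ A ∨ (i, j + 1) ∈ A ∨ (i + 1, j + 1) ∈ A
      · have hnear : ∀ x y : ℤ, (x = i ∨ x = i + 1) → (y = j ∨ y = j + 1) → (x, y) ∉ A →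
            (x, y) ∈ V := by
          intro x y hx hy hxy
          refine ⟨hxy, Or.inr ?_⟩
          have hsup : ∀ x' y' : ℤ, (x' = i ∨ x' = i + 1) → (y' = j ∨ y' = j + 1) →
              supN ((x, y) - (x', y')) ≤ 1 := by
            intro x' y' hx' hy'
            rw [supN_le_iff]
            simp only [Prod.mk_sub_mk, abs_le]
            omega
          rcases hcorner with h | h | h | h
          · exact ⟨_, h, hsup _ _ (by omega) (by omega)⟩
          · exact ⟨_, h, hsup _ _ (by omega) (by omega)⟩
          · exact ⟨_, h, hsup _ _ (by omega) (by omega)⟩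
          · exact ⟨_, h, hsup _ _ (by omega) (by omega)⟩
        have e1 := hω0 (i, j) (1, 0) hr (hnear _ _ (by omega) (by omega))
          (hnear _ _ (by omega) (by omega))
        have e2 := hω0 (i + 1, j) (0, 1) hu (hnear _ _ (by omega) (by omega))
          (hnear _ _ (by omega) (by omega))
        have e3 := hω0 (i, j) (0, 1) hu (hnear _ _ (by omega) (by omega))
          (hnear _ _ (by omega) (by omega))
        have e4 := hω0 (i, j + 1) (1, 0) hr (hnear _ _ (by omega) (by omega))
          (hnear _ _ (by omega) (by omega))
        rw [e1, e2, e3, e4]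
      · push Not at hcorner
        obtain ⟨h1, h2, h3, h4⟩ := hcorner
        simp only [hω, Prod.mk_add_mk, add_zero, h1, h2, h3, h4, or_self, if_false]
        generalize χ (i, j) = a
        generalize χ (i + 1, j) = b
        generalize χ (i, j + 1) = c
        generalize χ (i + 1, j + 1) = d
        revert a b c d
        decide)
  -- Each edge of the ray touches A or has both ends in V, so the potential g of ω is constant along
  -- it. Along the given path off A it is g + χ that is constant; hence χ agrees at both ends.
  have hray : ∀ i : ℕ, i ≤ N → g i 0 = g 0 0 := by
    intro i hi
    induction i with
    | zero => rfl
    | succ i ih =>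
      have h1 := hg1 i 0
      have h2 := hω0 ((i : ℤ), 0) (1, 0) hr (fun h => ⟨h, Or.inl ⟨i, by omega, rfl⟩⟩)
        (fun h => ⟨h, Or.inl ⟨i + 1, hi, by ext <;> simp⟩⟩)
      rw [h2, add_zero, ih (by omega)] at h1
      exact_mod_cast h1
  have hcons : ∀ {k p q}, LatticePath (A : Set (ℤ × ℤ))ᶜ k p q →
      g q.1 q.2 + χ q = g p.1 p.2 + χ p := by
    intro k p q h
    induction h with
    | refl p hp => rfl
    | @step k p q e h he hq ih =>
      rw [← ih]
      have hqA : q ∉ A := by simpa using h.right_mem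
      have hqeA : q + e ∉ A := by simpa using hq
      obtain ⟨x, y⟩ := q
      simp only [unitSteps, Finset.mem_insert, Finset.mem_singleton] at he
      rcases he with rfl | rfl | rfl | rfl
      · have := hg1 x y
        simp only [hω, hqA, hqeA, or_self, if_false] at this
        simp only [Prod.mk_add_mk, add_zero] at this ⊢
        rw [this]
        generalize χ (x + 1, y) = a
        generalize χ (x, y) = b
        generalize g x y = c
        revert a b c
        decide
      · have := hg1 (x + -1) y
        simp only [Prod.mk_add_mk, add_zero, neg_add_cancel_right] at this hqeA ⊢
        simp only [hω, hqA, hqeA, or_self, if_false] at this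
        rw [this]
        generalize χ (x + -1, y) = a
        generalize χ (x, y) = b
        generalize g (x + -1) y = c
        revert a b c
        decide
      · have := hg2 x y
        simp only [hω, hqA, hqeA, or_self, if_false] at this
        simp only [Prod.mk_add_mk, add_zero] at this ⊢
        rw [this]
        generalize χ (x, y + 1) = a
        generalize χ (x, y) = b
        generalize g x y = c
        revert a b c
        decide
      · have := hg2 x (y + -1)
        simp only [Prod.mk_add_mk, add_zero, neg_add_cancel_right] at this hqeA ⊢
        simp only [hω, hqA, hqeA, or_self, if_false] at this
        rw [this]
        generalize χ (x, y + -1) = a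
        generalize χ (x, y) = b
        generalize g x (y + -1) = c
        revert a b c
        decide
  have h1 := hcons hpath
  simp only [hray N le_rfl, add_right_inj] at h1
  have h0V : ((0, 0) : ℤ × ℤ) ∈ V :=
    ⟨by simpa using hpath.left_mem, Or.inl ⟨0, by omega, by simp⟩⟩
  have h2 : χ (0, 0) = 1 := if_pos ⟨0, .refl _ h0V⟩
  rw [h2] at h1
  by_contra hcon
  have h3 : χ ((N : ℤ), 0) = 0 := if_neg hcon
  rw [h3] at h1
  exact absurd h1 (by decide)

/-! ### The dichotomy near the origin. -/

/-- Lower bound near the target: on a free ring around the origin, `F` is either identically zero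
from there on or exponentially bounded below. -/
theorem ring_lower_bound {A : Finset (ℤ × ℤ)} {F : ℤ × ℤ → ℝ} (h0A : ((0, 0) : ℤ × ℤ) ∈ A)
    (h0 : ∀ w, 0 ≤ F w) (h1 : ∀ w, F w ≤ 1) (hF0 : F (0, 0) = 1)
    (hFA : ∀ a ∈ A, a ≠ (0, 0) → F a = 0) (hh : ∀ w, w ∉ A → F w = nbrAvg F w) {N : ℕ}
    (hN : 1 ≤ N) (hfree : ∀ a ∈ A, supN a ≠ N) :
    (∀ w, (N : ℤ) ≤ supN w → F w = 0) ∨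
      ∀ w, supN w = N → (1 / 4 : ℝ) ^ (9 * A.card + 9 * N + 1) ≤ F w := by
  classical
  set A' := A.erase (0, 0) with hA'
  have hA'c : ∀ w, w ∈ (A' : Set (ℤ × ℤ))ᶜ ↔ w = (0, 0) ∨ w ∉ A := by
    intro w
    simp only [hA', Set.mem_compl_iff, Finset.coe_erase, Set.mem_sdiff, Finset.mem_coe,
      Set.mem_singleton_iff]
    tauto
  have hringc : ∀ v, supN v = N → v ∈ (A' : Set (ℤ × ℤ))ᶜ := fun v hv =>
    (hA'c v).mpr (Or.inr fun h => hfree v h hv)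
  have hring : ∀ w, supN w = N → ∃ k ≤ 8 * N, LatticePath (A' : Set (ℤ × ℤ))ᶜ k ((N : ℤ), 0) w :=
    fun w hw => LatticePath.ring (by simp) hw hringc
  by_cases hreach : ∃ k, LatticePath (A' : Set (ℤ × ℤ))ᶜ k (0, 0) ((N : ℤ), 0)
  · right
    obtain ⟨k, hk⟩ := hreach
    obtain ⟨l, hl⟩ := connected_along_boundary A' N hk
    set V : Finset (ℤ × ℤ) := ((Finset.range (N + 1)).image fun i : ℕ => ((i : ℤ), (0 : ℤ))) ∪
      A'.biUnion (fun a => (Finset.Icc (-1 : ℤ) 1 ×ˢ Finset.Icc (-1 : ℤ) 1).image (a + ·)) with hVdef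
    -- The 9 counts the three-by-three block around each obstacle. Adding at most 8N steps along the
    -- ring gives the exponent in the statement.
    have hVcard : (V.filter fun v => v ∉ A').card ≤ (N + 1) + A.card * 9 := by
      refine (Finset.card_filter_le _ _).trans ((Finset.card_union_le _ _).trans ?_)
      apply add_le_add
      · exact Finset.card_image_le.trans (by simp)
      · refine (Finset.card_biUnion_le_card_mul _ _ 9 fun a _ => ?_).trans
          (Nat.mul_le_mul_right _ (Finset.card_erase_le))
        exact Finset.card_image_le.trans (by simp)
    have hl' : LatticePath ((V.filter fun v => v ∉ A' : Finset (ℤ × ℤ)) : Set (ℤ × ℤ)) l (0, 0)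
        ((N : ℤ), 0) := by
      refine hl.mono fun v hv => ?_
      rw [Finset.coe_filter]
      refine ⟨?_, hv.1⟩
      rw [hVdef, Finset.mem_union]
      rcases hv.2 with ⟨i, hi, rfl⟩ | ⟨a, ha, hva⟩
      · left; exact Finset.mem_image.mpr ⟨i, by simpa using by omega, rfl⟩
      · right
        rw [supN_le_iff, abs_le, abs_le] at hva
        exact Finset.mem_biUnion.mpr ⟨a, ha, Finset.mem_image.mpr ⟨v - a,
          Finset.mem_product.mpr ⟨Finset.mem_Icc.mpr hva.1, Finset.mem_Icc.mpr hva.2⟩, by simp⟩⟩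
    obtain ⟨j, hj, hpath⟩ := LatticePath.exists_lt_card _ hl'
    intro w hw
    obtain ⟨i, hi, hpath'⟩ := hring w hw
    have hpath'' := (hpath.mono (T := (A' : Set (ℤ × ℤ))ᶜ) (fun v hv => by
      have := (Finset.mem_filter.mp (Finset.mem_coe.mp hv)).2
      simpa using this)).trans hpath'
    have hdecay : ∀ {k p q}, LatticePath (A' : Set (ℤ × ℤ))ᶜ k p q →
        F p * (1 / 4) ^ k ≤ F q := by
      intro k p q h
      induction h with
      | refl p hp => simp
      | @step k p q e h he hq ih =>
        have h4 : F q / 4 ≤ F (q + e) := by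
          rcases (hA'c _).mp hq with h5 | h5
          · rw [h5, hF0]; linarith [h1 q]
          · rw [hh _ h5]
            have h6 : q = (q + e) + -e := by abel
            have h7 := neg_mem_unitSteps he
            conv_lhs => rw [h6]
            generalize q + e = v
            generalize -e = e' at h7
            simp only [unitSteps, Finset.mem_insert, Finset.mem_singleton] at h7
            unfold nbrAvg
            have b1 := h0 (v + (1, 0))
            have b2 := h0 (v + (-1, 0))
            have b3 := h0 (v + (0, 1))
            have b4 := h0 (v + (0, -1))
            rcases h7 with rfl | rfl | rfl | rfl <;> linarith
        rw [pow_succ]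
        linarith
    have := hdecay hpath''
    rw [hF0, one_mul] at this
    refine le_trans ?_ this
    exact pow_le_pow_of_le_one (by norm_num) (by norm_num) (by omega)
  · left
    push Not at hreach
    have hring0 : ∀ w, supN w = N → F w ≤ 0 := by
      intro w hw
      -- Points outside A not joined to the origin: the only boundary of this set consists of points
      -- of A other than the origin, where F vanishes.
      refine max_principle (Ω := {w | w ∉ A ∧ ∀ k, ¬LatticePath (A' : Set (ℤ × ℤ))ᶜ k (0, 0) w})
        ⟨(0, 0), fun h => h.1 h0A⟩ (u := F) (C := 1) (fun w _ => h1 w)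
        (fun w hw => (hh w hw.1).le) (fun w hw e he hne => ?_) w
        ⟨fun h => hfree w h hw, fun k hk => ?_⟩
      · have hwc := (hA'c w).mpr (Or.inr hw.1)
        have hback : ∀ k, ¬LatticePath (A' : Set (ℤ × ℤ))ᶜ k (0, 0) (w + e) := fun k hk => by
          have h2 := LatticePath.single hk.right_mem (neg_mem_unitSteps he) (by simpa using hwc)
          rw [add_neg_cancel_right] at h2
          exact hw.2 _ (hk.trans h2)
        by_cases hA : w + e ∈ A
        · by_cases hz : w + e = (0, 0)
          · refine absurd ?_ (hback 0)
            rw [hz]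
            exact .refl _ ((hA'c _).mpr (Or.inl rfl))
          · exact (hFA _ hA hz).le
        · exact absurd ⟨hA, hback⟩ hne
      · obtain ⟨i, -, hi⟩ := hring w hw
        exact hreach _ (hk.trans hi.symm)
    intro w hw
    apply le_antisymm _ (h0 w)
    have hzero : ∀ a ∈ A, (N : ℤ) ≤ supN a → F a = 0 := fun a ha hNa =>
      hFA a ha fun h => by rw [h] at hNa; simp [supN] at hNa; omega
    by_cases hwA : w ∈ A
    · exact (hzero w hwA hw).le
    rcases hw.eq_or_lt with hw | hw
    · exact hring0 w hw.symm
    refine max_principle (Ω := {w | (N : ℤ) < supN w ∧ w ∉ A}) ⟨(0, 0), fun h => h.2 h0A⟩ (u := F)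
      (C := 1) (fun w _ => h1 w) (fun w hw => (hh w hw.2).le) (fun w hw e he hne => ?_) w ⟨hw, hwA⟩
    have h2 := (supN_add_unit (w := w) he).2
    have h3 := hw.1
    by_cases hA : w + e ∈ A
    · exact (hzero _ hA (by omega)).le
    · refine hring0 _ ?_
      have h4 : ¬ (N : ℤ) < supN (w + e) := fun h => hne ⟨h, hA⟩
      omega

/-! ### Assembly of the bounds and the theorem. -/

theorem exists_free_ring (A : Finset (ℤ × ℤ)) :
    ∃ N : ℕ, 1 ≤ N ∧ N ≤ A.card + 1 ∧ ∀ a ∈ A, supN a ≠ N := by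
  by_contra hcon
  push Not at hcon
  have hsub : Finset.Icc 1 (A.card + 1) ⊆ A.image fun a => (supN a).toNat := by
    intro N hN
    rw [Finset.mem_Icc] at hN
    obtain ⟨a, ha, hNa⟩ := hcon N hN.1 hN.2
    exact Finset.mem_image.mpr ⟨a, ha, by simp [hNa]⟩
  have := (Finset.card_le_card hsub).trans Finset.card_image_le
  simp at this

theorem eq_zero_or_le_of_tendsto {F : ℤ × ℤ → ℝ} {L β : ℝ}
    (hL : Tendsto F (Bornology.cobounded (ℤ × ℤ)) (𝓝 L))
    (h : (∃ R : ℤ, ∀ w, R ≤ supN w → F w = 0) ∨ ∃ R : ℤ, ∀ w, R ≤ supN w → β ≤ F w) :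
    L = 0 ∨ β ≤ L := by
  rcases h with h | h
  · left
    refine tendsto_nhds_unique hL (tendsto_const_nhds.congr' ?_)
    filter_upwards [eventually_cobounded_iff.mpr h] with w hw using hw.symm
  · right
    exact ge_of_tendsto hL (eventually_cobounded_iff.mpr h)

/-- The dichotomy for sets of `n` points containing the origin, before simplification of the
bound. -/
theorem vanishes_or_lower_bound {A : Finset (ℤ × ℤ)} {F : ℤ × ℤ → ℝ}
    (h0A : ((0, 0) : ℤ × ℤ) ∈ A) (h0 : ∀ w, 0 ≤ F w) (h1 : ∀ w, F w ≤ 1) (hF0 : F (0, 0) = 1)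
    (hFA : ∀ a ∈ A, a ≠ (0, 0) → F a = 0) (hh : ∀ w, w ∉ A → F w = nbrAvg F w) {n B : ℕ}
    (hn : A.card = n) (hB : 19319041 ≤ B) :
    (∃ R : ℤ, ∀ w, R ≤ supN w → F w = 0) ∨ ∃ R : ℤ, ∀ w, R ≤ supN w →
      (1 / 4) ^ (1180 * n) * (1 / 6) ^ (1170 * (64 * n)) * ((1 / 6) ^ B / (22 * n)) ^ (2 * n) ≤
        F w := by
  have hn1 : 1 ≤ n := hn ▸ Finset.card_pos.mpr ⟨_, h0A⟩
  have hs : ∀ w, w ∉ A → nbrAvg F w ≤ F w := fun w hw => (hh w hw).ge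
  obtain ⟨i, hi, hfree⟩ := exists_spaced_away (A.image supN) n
    (Finset.card_image_le.trans hn.le) (32 * (n + 1)) 16 (by norm_num)
  -- A starting ring of radius O(n) whose free layer has half-width 16 = 8ρ with ρ = 2; hence the
  -- aspect ratio is at most 32(n + 1).
  obtain ⟨t, ht⟩ : ∃ t : ℕ, t = 32 * (n + 1) + 32 * i := ⟨_, rfl⟩
  have hclear : ∀ a ∈ A, 16 ≤ |supN a - t| := fun a ha => by
    have := hfree _ (Finset.mem_image_of_mem supN ha)
    have h2 : (32 * (n + 1) + 2 * 16 * i : ℤ) = t := by rw [ht]; push_cast; ring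
    rwa [h2] at this
  by_cases hvan : ∃ R : ℤ, ∀ w, R ≤ supN w → F w = 0
  · exact Or.inl hvan
  right
  have hring : ∀ w, |supN w - t| ≤ 2 → (1 / 4 : ℝ) ^ (1180 * n) ≤ F w := by
    intro w hw
    obtain ⟨N, hN⟩ : ∃ N : ℕ, supN w = N := ⟨(supN w).toNat, by have := supN_nonneg w; omega⟩
    rw [hN, abs_le] at hw
    have hNfree : ∀ a ∈ A, supN a ≠ N := fun a ha h => by
      have := hclear a ha
      rw [h, le_abs] at this
      omega
    rcases ring_lower_bound h0A h0 h1 hF0 hFA hh (by omega) hNfree with h | h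
    · exact absurd ⟨_, h⟩ hvan
    · exact le_trans (pow_le_pow_of_le_one (by norm_num) (by norm_num) (by omega)) (h w hN)
  obtain ⟨R, hR⟩ := multiscale_lower_bound h0 hs hn1 hn.le hB (2 * n) t 2 (32 * (n + 1)) _
    (by omega) le_rfl (by omega) (by positivity) (fun a ha => by simpa using hclear a ha)
    (fun w hw => hring w (by simpa using hw)) (hn ▸ outerCount_le A t)
  refine ⟨R, fun w hw => le_trans ?_ (hR w hw)⟩
  have hexp : 1170 * (32 * (n + 1)) ≤ 1170 * (64 * n) := by omega
  obtain ⟨E, hE⟩ : ∃ E, E = 1170 * (32 * (n + 1)) := ⟨_, rfl⟩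
  obtain ⟨E', hE'⟩ : ∃ E, E = 1170 * (64 * n) := ⟨_, rfl⟩
  rw [← hE, ← hE'] at hexp ⊢
  have := pow_le_pow_of_le_one (by norm_num : (0 : ℝ) ≤ 1 / 6) (by norm_num) hexp
  gcongr

/-- If every free ring encloses all of `A`, the lower bound is exponential. -/
theorem vanishes_or_exponential_lower_bound {A : Finset (ℤ × ℤ)} {F : ℤ × ℤ → ℝ}
    (h0A : ((0, 0) : ℤ × ℤ) ∈ A) (h0 : ∀ w, 0 ≤ F w) (h1 : ∀ w, F w ≤ 1) (hF0 : F (0, 0) = 1)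
    (hFA : ∀ a ∈ A, a ≠ (0, 0) → F a = 0) (hh : ∀ w, w ∉ A → F w = nbrAvg F w)
    (hconn : ∀ N : ℕ, 1 ≤ N → (∀ a ∈ A, supN a ≠ N) → ∀ a ∈ A, supN a < N) :
    (∃ R : ℤ, ∀ w, R ≤ supN w → F w = 0) ∨
      ∃ R : ℤ, ∀ w, R ≤ supN w → (1 / 4) ^ (28 * A.card) ≤ F w := by
  have hn1 : 1 ≤ A.card := Finset.card_pos.mpr ⟨_, h0A⟩
  obtain ⟨N, hN1, hN2, hfree⟩ := exists_free_ring A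
  rcases ring_lower_bound h0A h0 h1 hF0 hFA hh hN1 hfree with h | h
  · exact Or.inl ⟨_, h⟩
  · refine Or.inr ⟨N, outside_step h0 (fun w hw => (hh w hw).ge) (by omega)
      (fun a ha => (hconn N hN1 hfree a ha).le) fun w hw => le_trans ?_ (h w hw)⟩
    exact pow_le_pow_of_le_one (by norm_num) (by norm_num) (by omega)

/-- Absorbing the factors exponential in n into n log n needs log n bounded below, so n = 1 is
excluded here and treated directly in the theorem. -/
theorem exists_exp_le_bound (B : ℕ) : ∃ c : ℝ, 0 < c ∧ (∀ n : ℕ, 2 ≤ n →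
    Real.exp (-(c * n * Real.log n)) ≤
      (1 / 4) ^ (1180 * n) * (1 / 6) ^ (1170 * (64 * n)) * ((1 / 6) ^ B / (22 * n)) ^ (2 * n)) ∧
    ∀ n : ℕ, Real.exp (-(c * n)) ≤ (1 / 4) ^ (28 * n) := by
  have l4 : 0 < Real.log 4 := Real.log_pos (by norm_num)
  have l6 : 0 < Real.log 6 := Real.log_pos (by norm_num)
  have l22 : 0 < Real.log 22 := Real.log_pos (by norm_num)
  set K : ℝ := 1180 * Real.log 4 + 1170 * 64 * Real.log 6 + 2 * (B * Real.log 6) +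
    2 * Real.log 22 with hK
  have hB0 : 0 ≤ B * Real.log 6 := by positivity
  have hKpos : 0 < K := by positivity
  refine ⟨2 * K + 2, by positivity, fun n hn => ?_, fun n => ?_⟩
  · have hn' : (2 : ℝ) ≤ n := by exact_mod_cast hn
    rw [← Real.le_log_iff_exp_le (by positivity), Real.log_mul (by positivity) (by positivity),
      Real.log_mul (by positivity) (by positivity), Real.log_pow, Real.log_pow, Real.log_pow,
      Real.log_div (x := (1 / 6) ^ B) (by positivity) (by positivity), Real.log_pow,
      Real.log_mul (by norm_num) (by positivity), one_div, one_div, Real.log_inv, Real.log_inv]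
    push_cast
    have hlogn : 1 / 2 ≤ Real.log n := by
      have h1 := Real.log_two_gt_d9
      have h2 := Real.log_le_log (by norm_num) hn'
      linarith
    have h3 : K * n ≤ 2 * K * n * Real.log n := by
      have : 0 ≤ K * n := by positivity
      nlinarith
    have h4 : K * n = 1180 * n * Real.log 4 + 1170 * (64 * n) * Real.log 6 +
        2 * n * (B * Real.log 6) + 2 * n * Real.log 22 := by rw [hK]; ring
    nlinarith
  · rw [← Real.le_log_iff_exp_le (by positivity), Real.log_pow, one_div, Real.log_inv]
    push_cast
    have h1 : 28 * Real.log 4 ≤ 2 * K + 2 := by rw [hK]; linarith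
    have h2 : (0 : ℝ) ≤ n := by positivity
    nlinarith

/-- A lattice step changes the sup norm by at most one, so a walk in A cannot jump over a radius
that A does not meet. -/
theorem supN_sub_lt_of_walk {A : Finset (ℤ × ℤ)} {x : ℤ × ℤ} {N : ℤ}
    (hfree : ∀ a ∈ A, supN (a - x) ≠ N) {u v : (A : Set (ℤ × ℤ))}
    (w : (squareLattice.induce (A : Set (ℤ × ℤ))).Walk u v) (hu : supN ((u : ℤ × ℤ) - x) < N) :
    supN ((v : ℤ × ℤ) - x) < N := by
  induction w with
  | nil => exact hu
  | @cons u v w hadj _ ih =>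
    apply ih
    obtain ⟨e, he, hev⟩ := squareLattice_adj_iff.mp (SimpleGraph.comap_adj.mp hadj)
    have hev' : (v : ℤ × ℤ) = u + e := hev
    have h1 := (supN_add_unit (w := (u : ℤ × ℤ) - x) he).1
    rw [sub_add_eq_add_sub, ← hev'] at h1
    have h2 := hfree v v.2
    omega

theorem supN_sub_lt_of_connected {A : Finset (ℤ × ℤ)} {x : ℤ × ℤ} (hx : x ∈ A)
    (hA : IsLatticeConnected A) {N : ℤ} (hN : 1 ≤ N) (hfree : ∀ a ∈ A, supN (a - x) ≠ N) :
    ∀ a ∈ A, supN (a - x) < N := by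
  intro a ha
  have hxN : supN (x - x) < N := by
    have h0 : supN (x - x) = 0 := by simp [supN]
    omega
  have hreach : (squareLattice.induce (A : Set (ℤ × ℤ))).Reachable ⟨x, hx⟩ ⟨a, ha⟩ :=
    SimpleGraph.Connected.preconnected hA _ _
  exact hreach.elim fun w => supN_sub_lt_of_walk (u := ⟨x, hx⟩) (v := ⟨a, ha⟩) hfree w hxN

theorem tendsto_sub_cobounded (x : ℤ × ℤ) :
    Tendsto (fun z => z - x) (Bornology.cobounded (ℤ × ℤ)) (Bornology.cobounded (ℤ × ℤ)) := by
  rw [cobounded_eq_cofinite]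
  exact sub_left_injective.tendsto_cofinite

end HarmonicMeasureZ2

open HarmonicMeasureZ2 in
theorem theorem1 :
    ∃ c : ℝ, 0 < c ∧ ∀ (n : ℕ), 1 ≤ n → ∀ (A : Finset (ℤ × ℤ)), A.card = n → ∀ (x : ℤ × ℤ),
      Tendsto (fun z => HarmonicMeasureZ2.hittingDist A z x) (Bornology.cobounded (ℤ × ℤ))
          (𝓝 (HarmonicMeasureZ2.harmonicMeasure A x)) ∧
      (HarmonicMeasureZ2.harmonicMeasure A x = 0 ∨
        Real.exp (-(c * n * Real.log n)) ≤ HarmonicMeasureZ2.harmonicMeasure A x) ∧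
      (HarmonicMeasureZ2.IsLatticeConnected A →
        HarmonicMeasureZ2.harmonicMeasure A x = 0 ∨
          Real.exp (-(c * n)) ≤ HarmonicMeasureZ2.harmonicMeasure A x) := by
  obtain ⟨B, hB⟩ : ∃ B : ℕ, 19319041 ≤ B := ⟨_, le_rfl⟩
  obtain ⟨c, hc, hc1, hc2⟩ := exists_exp_le_bound B
  refine ⟨c, hc, fun n hn A hA x => ?_⟩
  by_cases hx : x ∈ A
  swap
  · have hzero : ∀ z, hittingDist A z x = 0 := by
      intro z
      have : firstHitEvent A x z = ∅ := by
        ext ξ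
        simp only [firstHitEvent, Set.mem_ofPred_eq, Set.mem_empty_iff_false, iff_false]
        rintro ⟨t, h1, -, h2⟩
        exact hx (h2 ▸ h1)
      rw [hittingDist_eq, this, measureReal_empty]
    have hlim : Tendsto (fun z => hittingDist A z x) (Bornology.cobounded (ℤ × ℤ)) (𝓝 0) := by
      simp only [hzero]; exact tendsto_const_nhds
    have hH : harmonicMeasure A x = 0 := hlim.limUnder_eq
    exact ⟨hH ▸ hlim, Or.inl hH, fun _ => Or.inl hH⟩
  set A₀ := A.image fun a => a - x with hA₀
  have hmem : ∀ w, w ∈ A₀ ↔ w + x ∈ A := by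
    intro w
    rw [hA₀, Finset.mem_image]
    exact ⟨fun ⟨a, ha, h⟩ => by rw [← h, sub_add_cancel]; exact ha,
      fun h => ⟨w + x, h, add_sub_cancel_right _ _⟩⟩
  have hcard : A₀.card = n := by
    rw [hA₀, Finset.card_image_of_injective _ sub_left_injective, hA]
  set F : ℤ × ℤ → ℝ := fun w => hitProb A x (w + x) with hF
  have h0A : ((0, 0) : ℤ × ℤ) ∈ A₀ := (hmem _).mpr (by
    change (0 : ℤ × ℤ) + x ∈ A
    rwa [zero_add])
  have h0 : ∀ w, 0 ≤ F w := fun w => hitProb_nonneg A x _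
  have h1 : ∀ w, F w ≤ 1 := fun w => hitProb_le_one A x _
  have hF0 : F (0, 0) = 1 := by
    have : ((0, 0) : ℤ × ℤ) + x = x := zero_add x
    simp only [hF, this, hitProb, if_pos hx, if_true]
  have hFA : ∀ a ∈ A₀, a ≠ (0, 0) → F a = 0 := by
    intro a ha hne
    have h2 : a + x ≠ x := fun h => hne (add_eq_right.mp h)
    simp only [hF, hitProb, if_pos ((hmem a).mp ha), if_neg h2]
  have hh : ∀ w, w ∉ A₀ → F w = nbrAvg F w := by
    intro w hw
    have h2 : F w = hittingDist A (w + x) x := by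
      simp only [hF, hitProb, if_neg fun h => hw ((hmem w).mpr h)]
    rw [h2, hittingDist_eq_nbrAvg]
    simp only [nbrAvg, hF, add_right_comm]
  obtain ⟨r, hr⟩ := (A₀.finite_toSet.image supN).bddAbove
  obtain ⟨L, hL⟩ := exists_tendsto_of_harmonic (r := r) h0 h1 fun w hw => hh w fun h => by
    have := hr ⟨w, h, rfl⟩
    omega
  have hlim : Tendsto (fun z => hittingDist A z x) (Bornology.cobounded (ℤ × ℤ)) (𝓝 L) := by
    refine (hL.comp (tendsto_sub_cobounded x)).congr' ?_
    obtain ⟨r', hr'⟩ := (A.finite_toSet.image supN).bddAbove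
    filter_upwards [eventually_cobounded_iff.mpr ⟨r' + 1, fun w h => h⟩] with z hz
    have hzA : z ∉ A := fun h => by
      have := hr' ⟨z, h, rfl⟩
      omega
    simp only [Function.comp_apply, hF, sub_add_cancel, hitProb, if_neg hzA]
  have hH : harmonicMeasure A x = L := hlim.limUnder_eq
  rw [hH]
  refine ⟨hlim, ?_, fun hconn => ?_⟩
  · rcases hn.eq_or_lt with hn1 | hn2
    -- For n = 1 the claimed bound is e⁰ = 1, which holds by recurrence: every walk eventually hits
    -- the single point of A.
    · right
      rw [← hn1]
      simp only [Nat.cast_one, Real.log_one, mul_zero, neg_zero, Real.exp_zero]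
      have hall : ∀ a ∈ A₀, supN a ≤ 0 := by
        intro a ha
        have : a = (0, 0) := Finset.card_le_one.mp (by omega) a ha _ h0A
        rw [this]; simp [supN]
      refine ge_of_tendsto hL (Eventually.of_forall fun w => ?_)
      refine outside_step h0 (fun w hw => (hh w hw).ge) le_rfl hall (fun w hw => ?_) w
        (supN_nonneg w)
      rw [eq_zero_of_supN hw]
      exact hF0.ge
    · exact (eq_zero_or_le_of_tendsto hL
        (vanishes_or_lower_bound h0A h0 h1 hF0 hFA hh hcard hB)).imp_right (hc1 n hn2).trans
  · refine (eq_zero_or_le_of_tendsto hL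
      (vanishes_or_exponential_lower_bound h0A h0 h1 hF0 hFA hh fun N hN hfree a ha => ?_)).imp_right
      fun h => ?_
    · have := supN_sub_lt_of_connected hx hconn (N := N) (by omega)
        (fun a ha => hfree (a - x) ((hmem _).mpr (by rwa [sub_add_cancel]))) (a + x)
        ((hmem a).mp ha)
      rwa [add_sub_cancel_right] at this
    · rw [hcard] at h
      exact (hc2 n).trans h
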